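/- Let $c>0$ be real. Let $F_c:L^2[-1,1]\to L^2[-1,1]$ be the operator $F_c[\varphi](x)=\int_{-1}^1\varphi(t)e^{icxt}\,dt$, let $\lambda_0,\lambda_1,\dots$ be its eigenvalues (with multiplicity), ordered so that $|\lambda_n|\ge|\lambda_{n+1}|$, and let $\psi_n$ be corresponding real eigenfunctions (linearly independent) with $\|\psi_n\|_{L^2[-1,1]}=1$, so that $\lambda_n\psi_n(x)=\int_{-1}^1\psi_n(t)e^{icxt}\,dt$ for all $x\in[-1,1]$ (the prolate spheroidal wave functions of band limit $c$). For each integer $n\ge 0$ let $\chi_n$ denote the real number for which the prolate equation $$(1-x^2)y''(x)-2xy'(x)+(\chi_n-c^2x^2)y(x)=0\qquad(-1<x<1)$$ has a nonzero solution continuous on $[-1,1]$ and all such solutions are constant multiples of $\psi_n$; such a number exists and is unique. Let $P_0(t)=1$, $P_1(t)=t$, $Q_0(t)=\frac12\log\frac{1+t}{1-t}$, $Q_1(t)=\frac t2\log\frac{1+t}{1-t}-1$, where both sequences satisfy the recurrence $(k+1)y_{k+1}=(2k+1)t\,y_k-k\,y_{k-1}$ for $k\ge1$, and put $$\alpha_k^{(n)}=\left(k+\tfrac12\right)\int_{-1}^1\psi_n(x)P_k(x)\,dx,\qquad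 \tilde\Phi_n(t)=\sum_{k=0}^\infty\alpha_k^{(n)}Q_k(t)\quad(-1<t<1).$$ **Theorem.** For every integer $n\ge0$ the series defining $\tilde\Phi_n$ converges absolutely at every point of $(-1,1)$, its sum is infinitely differentiable on $(-1,1)$, and for all real $-1<t<1$: $$(1-t^2)\tilde\Phi_n''(t)-2t\,\tilde\Phi_n'(t)+(\chi_n-c^2t^2)\tilde\Phi_n(t)=-c^2\left(\alpha_0^{(n)}t+\alpha_1^{(n)}/3\right),$$ $$(1-t^2)\tilde\Phi_n'''(t)-4t\,\tilde\Phi_n''(t)+(\chi_n-c^2t^2-2)\tilde\Phi_n'(t)-2c^2t\,\tilde\Phi_n(t)=-c^2\alpha_0^{(n)},$$ and, for every integer $k\ge2$, $$(1-t^2)\tilde\Phi_n^{(k+2)}(t)-2(k+1)t\,\tilde\Phi_n^{(k+1)}(t)+\left(\chi_n-k(k+1)-c^2t^2\right)\tilde\Phi_n^{(k)}(t)-2c^2kt\,\tilde\Phi_n^{(k-1)}(t)-c^2k(k-1)\tilde\Phi_n^{(k-2)}(t)=0.$$ -/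

import Mathlib

open MeasureTheory Set
open scoped ContDiff

noncomputable section

/-- Lebesgue measure on the interval `[-1, 1]`. -/
abbrev volIcc : Measure ℝ := volume.restrict (Icc (-1 : ℝ) 1)

/-- The integral operator `F_c[φ](x) = ∫_{-1}^{1} φ(t) e^{icxt} dt`. -/
def prolateF (c : ℝ) (φ : ℝ → ℂ) (x : ℝ) : ℂ :=
  ∫ t in (-1 : ℝ)..1, φ t * Complex.exp (Complex.I * c * x * t)

/-- `lam 0, lam 1, …` is the list of all eigenvalues of `F_c : L²[-1,1] → L²[-1,1]`, repeated
according to multiplicity and ordered so that `|lam n| ≥ |lam (n+1)|`, and `ψ n` is a real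
eigenfunction for `lam n` with `L²[-1,1]`-norm one, the representative of its class being the one
for which the eigenvalue equation holds at every point of `[-1, 1]`.  These `ψ n` are the prolate
spheroidal wave functions of band limit `c`. -/
structure IsPSWFSystem (c : ℝ) (lam : ℕ → ℂ) (ψ : ℕ → ℝ → ℝ) : Prop where
  memLp : ∀ n, MemLp (ψ n) 2 volIcc
  norm_one : ∀ n, ∫ x in (-1 : ℝ)..1, (ψ n x) ^ 2 = 1
  eigen : ∀ n, ∀ x ∈ Icc (-1 : ℝ) 1,
    lam n * (ψ n x : ℂ) = prolateF c (fun t => (ψ n t : ℂ)) x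
  ordered : ∀ n, ‖lam (n + 1)‖ ≤ ‖lam n‖
  /-- No eigenvalue is repeated more often than its multiplicity. -/
  linIndep : LinearIndependent ℝ (fun n => (memLp n).toLp (ψ n))
  /-- No eigenvalue is missing or repeated less often than its multiplicity: the eigenspace of
  `mu` is spanned by the `ψ n` with `lam n = mu`. -/
  exhaust : ∀ (mu : ℂ) (φ : ℝ → ℂ), MemLp φ 2 volIcc →
    (∀ᵐ x ∂volIcc, prolateF c φ x = mu * φ x) →
    ∃ a : ℕ →₀ ℂ, (∀ n ∈ a.support, lam n = mu) ∧
      ∀ᵐ x ∂volIcc, φ x = ∑ n ∈ a.support, a n * (ψ n x : ℂ)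

/-- `y` is continuous on `[-1, 1]`, twice differentiable on `(-1, 1)`, and solves there
`(1 - x²) y'' - 2 x y' + (χ - c² x²) y = 0`. -/
def IsContSolProlateODE (c χ : ℝ) (y : ℝ → ℝ) : Prop :=
  ContinuousOn y (Icc (-1 : ℝ) 1) ∧
  ∀ x ∈ Ioo (-1 : ℝ) 1,
    DifferentiableAt ℝ y x ∧ DifferentiableAt ℝ (deriv y) x ∧
    (1 - x ^ 2) * deriv (deriv y) x - 2 * x * deriv y x + (χ - c ^ 2 * x ^ 2) * y x = 0

/-- `χ` is the eigenvalue of the prolate differential operator that belongs to `ψ`: the prolate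
equation with parameter `χ` has a nonzero solution continuous on `[-1, 1]`, and all solutions
continuous on `[-1, 1]` are constant multiples of `ψ`. -/
structure IsProlateEigenvalue (c : ℝ) (ψ : ℝ → ℝ) (χ : ℝ) : Prop where
  exists_sol : ∃ y, IsContSolProlateODE c χ y ∧ ∃ x ∈ Icc (-1 : ℝ) 1, y x ≠ 0
  multiple : ∀ y, IsContSolProlateODE c χ y →
    ∃ a : ℝ, ∀ x ∈ Icc (-1 : ℝ) 1, y x = a * ψ x

/-- Legendre polynomials `P_k`: `(k+1) P_{k+1} = (2k+1) t P_k - k P_{k-1}`. -/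
def legP : ℕ → ℝ → ℝ
  | 0, _ => 1
  | 1, t => t
  | k + 2, t => ((2 * (k : ℝ) + 3) * t * legP (k + 1) t - ((k : ℝ) + 1) * legP k t) / ((k : ℝ) + 2)

/-- Legendre functions of the second kind `Q_k` (on `(-1, 1)`), with the same recurrence. -/
def legQ : ℕ → ℝ → ℝ
  | 0, t => 1 / 2 * Real.log ((1 + t) / (1 - t))
  | 1, t => t / 2 * Real.log ((1 + t) / (1 - t)) - 1
  | k + 2, t => ((2 * (k : ℝ) + 3) * t * legQ (k + 1) t - ((k : ℝ) + 1) * legQ k t) / ((k : ℝ) + 2)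

/-- Legendre coefficients `α_k = (k + 1/2) ∫_{-1}^{1} ψ(x) P_k(x) dx`. -/
def legCoeff (ψ : ℝ → ℝ) (k : ℕ) : ℝ :=
  ((k : ℝ) + 1 / 2) * ∫ x in (-1 : ℝ)..1, ψ x * legP k x

/-- `Φ̃(t) = ∑_k α_k Q_k(t)`, meant for `-1 < t < 1`. -/
def tildePhi (ψ : ℝ → ℝ) (t : ℝ) : ℝ :=
  ∑' k : ℕ, legCoeff ψ k * legQ k t

end

open scoped Interval

/-! `P_k` and `Q_k` satisfy the same Legendre equation `((1 - t²) y')' = -k(k+1) y` and the same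
recurrence. Pairing the prolate equation for `ψ_n` with `P_k` turns it into a relation between
`k(k+1) α_k`, `χ α_k` and the Legendre coefficients of `x² ψ_n` (`legCoeff_rel`). Summing that
relation against `Q_k` reproduces the prolate equation up to one defect at the bottom of the
recurrence: `t P_0 = P_1`, but `t Q_0 = Q_1 + 1`. Each multiplication by `t` therefore costs a
constant (`IsMulXCoeff.legQSum_eq`), and two of them produce the right side `-c² (α_0 t + α_1 / 3)`.
The higher equations follow by differentiation.

Convergence and smoothness are easy: `ψ_n` is a Fourier integral over a bounded interval, so Taylor
expansion of the kernel makes `α_k` decay faster than any geometric sequence, while `Q_k` grows at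
most geometrically on compact subsets of `(-1, 1)`.

The harder point is that `ψ_n`, given only as an eigenfunction of the integral operator, solves a
prolate equation. The differential operator commutes with `F_c` (`prolateOp_eig`), so it suffices
that the eigenfunctions of one parity with nonzero eigenvalue `lam` form a line, that is, that none
but zero vanishes at `1` (`eq_zero_of_apply_one`). If `f(1) = 0`, then `z f' + f/2` is an
eigenfunction for `-lam`. An eigenfunction for `lam` and one for `-lam` of the same parity have
values at `1` with product zero (`boundary_eq_zero`). But the differential operator lowers the order
of vanishing at `1`, so iterating it makes both values nonzero. Finally, `χ_n` is identified by a
Wronskian argument: a second solution has a logarithmic singularity at `1`. -/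

/-! ### Legendre functions: recurrence, derivatives, fluxes -/

/-- The three-term recurrence of the Legendre functions. -/
def LegRec (y : ℕ → ℝ → ℝ) : Prop :=
  ∀ (k : ℕ) (t : ℝ), ((k : ℝ) + 2) * y (k + 2) t
    = (2 * (k : ℝ) + 3) * t * y (k + 1) t - ((k : ℝ) + 1) * y k t

theorem legRec_legP : LegRec legP := by
  intro k t
  have : (k : ℝ) + 2 ≠ 0 := by positivity
  rw [legP]; field_simp

theorem legRec_legQ : LegRec legQ := by
  intro k t
  have : (k : ℝ) + 2 ≠ 0 := by positivity
  rw [legQ]; field_simp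

/-- The derivative relations follow by induction from the recurrence. -/
theorem LegRec.exists_deriv {y : ℕ → ℝ → ℝ} (hy : LegRec y) {t d0 d1 : ℝ}
    (h0 : HasDerivAt (y 0) d0 t) (h1 : HasDerivAt (y 1) d1 t)
    (e1 : t * d1 - d0 = y 1 t) (e2 : d1 - t * d0 = y 0 t) (k : ℕ) :
    ∃ d d', HasDerivAt (y k) d t ∧ HasDerivAt (y (k + 1)) d' t ∧
      t * d' - d = ((k : ℝ) + 1) * y (k + 1) t ∧ d' - t * d = ((k : ℝ) + 1) * y k t := by
  induction k with
  | zero => exact ⟨d0, d1, h0, h1, by simpa using e1, by simpa using e2⟩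
  | succ k ih =>
    obtain ⟨d, d', hd, hd', a1, a2⟩ := ih
    have hk : (k : ℝ) + 2 ≠ 0 := by positivity
    have hrec := hy k t
    have hfun : y (k + 2) = fun s => ((2 * (k : ℝ) + 3) * s * y (k + 1) s
        - ((k : ℝ) + 1) * y k s) / ((k : ℝ) + 2) := by
      funext s
      rw [← hy k s]; field_simp
    refine ⟨d', ((2 * (k : ℝ) + 3) * (y (k + 1) t + t * d') - ((k : ℝ) + 1) * d) / ((k : ℝ) + 2),
      hd', ?_, ?_, ?_⟩
    · rw [show k + 1 + 1 = k + 2 from rfl, hfun]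
      have := (((((hasDerivAt_id t).const_mul (2 * (k : ℝ) + 3)).mul hd').sub
        (hd.const_mul ((k : ℝ) + 1))).div_const ((k : ℝ) + 2))
      refine this.congr_deriv ?_
      simp only [id, mul_one]
      ring
    · push_cast
      rw [show k + 1 + 1 = k + 2 from rfl]
      field_simp
      linear_combination (2 * (k : ℝ) + 3) * t * a1 - ((k : ℝ) + 2) * a2 - ((k : ℝ) + 2) * hrec
    · push_cast
      field_simp
      linear_combination ((k : ℝ) + 1) * a1

/-- The fluxes `(1 - t²) y_k'`, in terms of the `y_k`, for a solution
of the recurrence with flux `w` at `k = 0`. -/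
def legFlux (y : ℕ → ℝ → ℝ) (w : ℝ) : ℕ → ℝ → ℝ
  | 0, _ => w
  | k + 1, t => ((k : ℝ) + 1) * (y k t - t * y (k + 1) t)

/-- A sequence with the recurrence and the first derivative relations on `U`. -/
structure LegSeq (y : ℕ → ℝ → ℝ) (w : ℝ) (U : Set ℝ) : Prop where
  rec' : LegRec y
  base : ∀ t ∈ U, ∃ d0 d1, HasDerivAt (y 0) d0 t ∧ HasDerivAt (y 1) d1 t ∧
    t * d1 - d0 = y 1 t ∧ d1 - t * d0 = y 0 t ∧ (1 - t ^ 2) * d0 = w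

theorem LegSeq.hasDerivAt {y : ℕ → ℝ → ℝ} {w : ℝ} {U : Set ℝ} (h : LegSeq y w U) (k : ℕ)
    {t : ℝ} (ht : t ∈ U) : ∃ d, HasDerivAt (y k) d t ∧ (1 - t ^ 2) * d = legFlux y w k t := by
  obtain ⟨d0, d1, h0, h1, e1, e2, e3⟩ := h.base t ht
  cases k with
  | zero => exact ⟨d0, h0, e3⟩
  | succ k =>
    obtain ⟨d, d', -, hd', a1, a2⟩ := h.rec'.exists_deriv h0 h1 e1 e2 k
    refine ⟨d', hd', ?_⟩
    rw [legFlux]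
    linear_combination a2 - t * a1

/-- This is the Legendre equation in divergence form. Working with the flux avoids second
derivatives and division by `1 - t²`. -/
theorem LegSeq.hasDerivAt_flux {y : ℕ → ℝ → ℝ} {w : ℝ} {U : Set ℝ} (h : LegSeq y w U) (k : ℕ)
    {t : ℝ} (ht : t ∈ U) :
    HasDerivAt (legFlux y w k) (-((k : ℝ) * ((k : ℝ) + 1)) * y k t) t := by
  obtain ⟨d0, d1, h0, h1, e1, e2, e3⟩ := h.base t ht
  cases k with
  | zero => exact (hasDerivAt_const t w).congr_deriv (by simp)
  | succ k =>
    obtain ⟨d, d', hd, hd', a1, a2⟩ := h.rec'.exists_deriv h0 h1 e1 e2 k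
    have := (hd.sub ((hasDerivAt_id t).mul hd')).const_mul ((k : ℝ) + 1)
    refine this.congr_deriv ?_
    push_cast
    simp only [id]
    linear_combination (-(k : ℝ) - 1) * a1

theorem legSeq_legP : LegSeq legP 0 univ where
  rec' := legRec_legP
  base t _ := ⟨0, 1, hasDerivAt_const t (1 : ℝ), hasDerivAt_id t, by simp [legP], by simp [legP],
    by simp⟩

/-- The only differences from `legP` are the flux `(1 - t²) Q_0' = 1` in place of `0` and the
logarithmic singularities at `±1`. -/
theorem legSeq_legQ : LegSeq legQ 1 (Ioo (-1) 1) where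
  rec' := legRec_legQ
  base t ht := by
    have hp : (1 + t) ≠ 0 := by linarith [ht.1]
    have hm : (1 - t) ≠ 0 := by linarith [ht.2]
    have hs : (1 - t ^ 2) ≠ 0 := by
      rw [show 1 - t ^ 2 = (1 + t) * (1 - t) by ring]; exact mul_ne_zero hp hm
    have hl : HasDerivAt (fun s : ℝ => Real.log ((1 + s) / (1 - s))) (2 / (1 - t ^ 2)) t := by
      have := (((hasDerivAt_id t).const_add 1).div ((hasDerivAt_id t).const_sub 1) hm).log
        (div_ne_zero hp hm)
      refine this.congr_deriv ?_
      simp only [id, Pi.div_apply]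
      rw [show 1 - t ^ 2 = (1 + t) * (1 - t) by ring]
      field_simp
      ring
    refine ⟨1 / (1 - t ^ 2), 1 / 2 * Real.log ((1 + t) / (1 - t)) + t / (1 - t ^ 2), ?_, ?_, ?_,
      ?_, ?_⟩
    · exact (hl.const_mul (1 / 2)).congr_deriv (by ring)
    · have := (((hasDerivAt_id t).div_const 2).mul hl).sub_const 1
      exact this.congr_deriv (by simp only [id]; ring)
    · simp only [legQ]; field_simp; ring
    · simp only [legQ]; field_simp; ring
    · field_simp

/-! ### Geometric growth bounds -/

/-- The ratio `3` survives the recurrence because `3 (2k + 3) + (k + 1) ≤ 9 (k + 2)`. Any geometric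
bound is enough against `RapidDecay`. -/
theorem LegRec.abs_le {y : ℕ → ℝ → ℝ} (hy : LegRec y) {t M : ℝ} (ht : |t| ≤ 1)
    (h0 : |y 0 t| ≤ M) (h1 : |y 1 t| ≤ M * 3) (k : ℕ) : |y k t| ≤ M * 3 ^ k := by
  have hM : 0 ≤ M := (abs_nonneg _).trans h0
  suffices |y k t| ≤ M * 3 ^ k ∧ |y (k + 1) t| ≤ M * 3 ^ (k + 1) from this.1
  induction k with
  | zero => simpa using ⟨h0, h1⟩
  | succ k ih =>
    refine ⟨ih.2, ?_⟩
    have hk : (0 : ℝ) < (k : ℝ) + 2 := by positivity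
    have hr := hy k t
    have hb : ((k : ℝ) + 2) * |y (k + 2) t| ≤ (2 * (k : ℝ) + 3) * |y (k + 1) t|
        + ((k : ℝ) + 1) * |y k t| := by
      rw [← abs_of_pos hk, ← abs_mul, hr]
      refine (abs_sub _ _).trans ?_
      rw [abs_mul, abs_mul, abs_mul, abs_of_nonneg (by positivity : (0 : ℝ) ≤ 2 * (k : ℝ) + 3),
        abs_of_nonneg (by positivity : (0 : ℝ) ≤ (k : ℝ) + 1)]
      gcongr
      exact mul_le_of_le_one_right (by positivity) ht
    have h3 : (0 : ℝ) ≤ M * 3 ^ k := by positivity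
    have e1 : M * 3 ^ (k + 1) = 3 * (M * 3 ^ k) := by ring
    have e2 : M * 3 ^ (k + 1 + 1) = 9 * (M * 3 ^ k) := by ring
    rw [e1] at ih
    rw [e2]
    refine le_of_mul_le_mul_left ?_ hk
    have hkk : (0 : ℝ) ≤ k := by positivity
    nlinarith [mul_le_mul_of_nonneg_left ih.1 (by positivity : (0 : ℝ) ≤ (k : ℝ) + 1),
      mul_le_mul_of_nonneg_left ih.2 (by positivity : (0 : ℝ) ≤ 2 * (k : ℝ) + 3),
      mul_nonneg hkk h3]

theorem abs_legP_le {t : ℝ} (ht : |t| ≤ 1) (k : ℕ) : |legP k t| ≤ 3 ^ k := by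
  have := legRec_legP.abs_le (M := 1) ht (by simp [legP]) (by simp only [legP]; linarith) k
  simpa using this

theorem continuous_legP (k : ℕ) : Continuous (legP k) :=
  continuous_iff_continuousAt.2 fun t =>
    let ⟨_, hd, _⟩ := legSeq_legP.hasDerivAt k (mem_univ t)
    hd.continuousAt

theorem continuousOn_legQ (k : ℕ) : ContinuousOn (legQ k) (Ioo (-1) 1) := fun _ ht =>
  let ⟨_, hd, _⟩ := legSeq_legQ.hasDerivAt k ht
  hd.continuousAt.continuousWithinAt

/-- Local uniform growth bound for the functions of the second kind. -/
theorem exists_abs_legQ_le {r : ℝ} (hr : r < 1) :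
    ∃ M, 0 ≤ M ∧ ∀ t, |t| ≤ r → ∀ k, |legQ k t| ≤ M * 3 ^ k := by
  have hsub : Icc (-r) r ⊆ Ioo (-1 : ℝ) 1 := fun t ht => ⟨by linarith [ht.1], by linarith [ht.2]⟩
  obtain ⟨A, hA⟩ := (isCompact_Icc (a := -r) (b := r)).exists_bound_of_continuousOn
    ((continuousOn_legQ 0).mono hsub)
  obtain ⟨B, hB⟩ := (isCompact_Icc (a := -r) (b := r)).exists_bound_of_continuousOn
    ((continuousOn_legQ 1).mono hsub)
  refine ⟨|A| + |B|, by positivity, fun t ht k => ?_⟩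
  have htm : t ∈ Icc (-r) r := abs_le.1 ht
  refine legRec_legQ.abs_le (ht.trans hr.le) ?_ ?_ k
  · exact (hA t htm).trans ((le_abs_self A).trans (by linarith [abs_nonneg B]))
  · exact (hB t htm).trans ((le_abs_self B).trans (by linarith [abs_nonneg B, abs_nonneg A]))

theorem exists_abs_flux_legQ_le {r : ℝ} (hr : r < 1) :
    ∃ M, 0 ≤ M ∧ ∀ t, |t| ≤ r → ∀ k, |legFlux legQ 1 k t| ≤ M * 6 ^ k := by
  obtain ⟨M, hM, h⟩ := exists_abs_legQ_le hr
  refine ⟨1 + M, by positivity, fun t ht k => ?_⟩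
  cases k with
  | zero => simpa [legFlux] using hM
  | succ k =>
    rw [legFlux, abs_mul, abs_of_nonneg (by positivity : (0 : ℝ) ≤ (k : ℝ) + 1)]
    have h1 : |legQ k t - t * legQ (k + 1) t| ≤ M * 3 ^ k + M * 3 ^ (k + 1) := by
      refine (abs_sub _ _).trans (add_le_add (h t ht k) ?_)
      rw [abs_mul]
      exact (mul_le_of_le_one_left (abs_nonneg _) (ht.trans hr.le)).trans (h t ht (k + 1))
    have h2 : (k : ℝ) + 1 ≤ 2 ^ k := by exact_mod_cast Nat.lt_two_pow_self
    calc ((k : ℝ) + 1) * |legQ k t - t * legQ (k + 1) t|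
        ≤ 2 ^ k * (M * 3 ^ k + M * 3 ^ (k + 1)) := by gcongr
      _ = 4 * M * 6 ^ k := by rw [show (6 : ℝ) = 2 * 3 by norm_num, mul_pow]; ring
      _ ≤ (1 + M) * 6 ^ (k + 1) := by
        rw [pow_succ]
        have : (0 : ℝ) < 6 ^ k := by positivity
        nlinarith [mul_nonneg hM this.le]

/-! ### Orthogonality -/

/-- Orthogonality of `P_k` to lower powers, from the Legendre equation. -/
theorem integral_pow_mul_legP {k j : ℕ} (hj : j < k) :
    ∫ x in (-1 : ℝ)..1, x ^ j * legP k x = 0 := by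
  induction j using Nat.strong_induction_on with
  | _ j ih =>
    -- Lagrange's identity for `x^j` and `P_k`: the bracket vanishes at `±1`, which reduces the
    -- moment of order `j` to that of order `j - 2`. Where the natural subtractions truncate, the
    -- factor `j (j - 1)` is zero.
    have hder : ∀ x : ℝ, HasDerivAt
        (fun x => x ^ j * legFlux legP 0 k x - (1 - x ^ 2) * ((j : ℝ) * x ^ (j - 1)) * legP k x)
        (-((k : ℝ) * (k + 1) - (j : ℝ) * (j + 1)) * (x ^ j * legP k x)
          - (j : ℝ) * (j - 1 : ℕ) * (x ^ (j - 2) * legP k x)) x := by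
      intro x
      obtain ⟨d, hd, e⟩ := legSeq_legP.hasDerivAt k (mem_univ x)
      have hf := legSeq_legP.hasDerivAt_flux k (mem_univ x)
      have := ((hasDerivAt_pow j x).mul hf).sub
        ((((hasDerivAt_pow 2 x).const_sub 1).mul
          ((hasDerivAt_pow (j - 1) x).const_mul (j : ℝ))).mul hd)
      refine this.congr_deriv ?_
      simp only [Pi.mul_apply, ← e]
      rcases j with _ | _ | j
      · simp
      · simp; ring
      · simp only [Nat.add_sub_cancel, Nat.reduceSubDiff, Nat.cast_add, Nat.cast_one, pow_succ]
        push_cast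
        ring
    have hP := continuous_legP k
    have hint := intervalIntegral.integral_eq_sub_of_hasDerivAt (a := -1) (b := 1)
      (fun x _ => hder x) (Continuous.intervalIntegrable (by fun_prop) _ _)
    have hflux : legFlux legP 0 k 1 = 0 ∧ legFlux legP 0 k (-1) = 0 := by
      constructor
      · obtain ⟨d, hd, e⟩ := legSeq_legP.hasDerivAt k (mem_univ 1)
        rw [← e]; ring
      · obtain ⟨d, hd, e⟩ := legSeq_legP.hasDerivAt k (mem_univ (-1))
        rw [← e]; ring
    rw [intervalIntegral.integral_sub (Continuous.intervalIntegrable (by fun_prop) _ _)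
      (Continuous.intervalIntegrable (by fun_prop) _ _), intervalIntegral.integral_const_mul,
      intervalIntegral.integral_const_mul, hflux.1, hflux.2] at hint
    have hzero : (j : ℝ) * (j - 1 : ℕ) * ∫ x in (-1 : ℝ)..1, x ^ (j - 2) * legP k x = 0 := by
      rcases j with _ | _ | j
      · simp
      · simp
      · rw [ih (j + 2 - 2) (by omega) (by omega), mul_zero]
    rw [hzero] at hint
    have hne : (k : ℝ) * (k + 1) - (j : ℝ) * (j + 1) ≠ 0 := by
      have : (j : ℝ) + 1 ≤ k := by exact_mod_cast hj
      have h0 : (0 : ℝ) ≤ j := by positivity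
      nlinarith
    have : -((k : ℝ) * (k + 1) - (j : ℝ) * (j + 1)) * ∫ x in (-1 : ℝ)..1, x ^ j * legP k x = 0 := by
      linarith
    exact (mul_eq_zero.1 this).resolve_left (neg_ne_zero.2 hne)

/-! ### Rapidly decaying coefficients and termwise differentiation -/

/-- Decay faster than every geometric sequence. -/
def RapidDecay (a : ℕ → ℝ) : Prop :=
  ∀ R : ℝ, 0 < R → Summable fun k => |a k| * R ^ k

theorem RapidDecay.of_pow_mul_le {a b : ℕ → ℝ} (ha : RapidDecay a) {C r : ℝ} (hr : 0 < r)
    (h : ∀ k, |b k| ≤ C * r ^ k * |a k|) : RapidDecay b := fun R hR =>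
  Summable.of_nonneg_of_le (fun k => by positivity) (fun k => by
    calc |b k| * R ^ k ≤ C * r ^ k * |a k| * R ^ k := by gcongr; exact h k
      _ = C * (|a k| * (r * R) ^ k) := by rw [mul_pow]; ring) ((ha _ (mul_pos hr hR)).mul_left C)

theorem RapidDecay.add {a b : ℕ → ℝ} (ha : RapidDecay a) (hb : RapidDecay b) :
    RapidDecay fun k => a k + b k := fun R hR =>
  Summable.of_nonneg_of_le (fun k => by positivity) (fun k => by
    rw [← add_mul]; gcongr; exact abs_add_le _ _) ((ha R hR).add (hb R hR))

theorem RapidDecay.comp_succ {a : ℕ → ℝ} (ha : RapidDecay a) : RapidDecay fun k => a (k + 1) :=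
  fun R hR => by
    have := (((summable_nat_add_iff 1).2 (ha R hR)).mul_left R⁻¹)
    refine this.congr fun k => ?_
    rw [pow_succ]; field_simp

theorem RapidDecay.of_comp_succ {a : ℕ → ℝ} (ha : RapidDecay fun k => a (k + 1)) : RapidDecay a :=
  fun R hR => by
    refine (summable_nat_add_iff 1).1 (((ha R hR).mul_left R).congr fun k => ?_)
    rw [pow_succ]; ring

theorem natCast_add_one_le_two_pow (k : ℕ) : (k : ℝ) + 1 ≤ 2 ^ k := by
  exact_mod_cast Nat.lt_two_pow_self

theorem RapidDecay.eigen_mul {a : ℕ → ℝ} (ha : RapidDecay a) :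
    RapidDecay fun k => (k : ℝ) * ((k : ℝ) + 1) * a k := by
  refine ha.of_pow_mul_le (C := 1) (r := 4) (by norm_num) fun k => ?_
  have h := natCast_add_one_le_two_pow k
  rw [abs_mul, abs_of_nonneg (by positivity : (0 : ℝ) ≤ (k : ℝ) * ((k : ℝ) + 1))]
  refine mul_le_mul_of_nonneg_right ?_ (abs_nonneg _)
  calc (k : ℝ) * ((k : ℝ) + 1) ≤ 2 ^ k * 2 ^ k := by gcongr; linarith
    _ = 1 * 4 ^ k := by rw [← mul_pow]; norm_num

/-- `∑ a_k Q_k`. -/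
noncomputable def legQSum (a : ℕ → ℝ) (t : ℝ) : ℝ := ∑' k, a k * legQ k t

/-- `∑ a_k (1 - t²) Q_k'`. -/
noncomputable def legQFluxSum (a : ℕ → ℝ) (t : ℝ) : ℝ := ∑' k, a k * legFlux legQ 1 k t

theorem summable_of_geometric_bound {a : ℕ → ℝ} (ha : RapidDecay a) {M r : ℝ} (hr : 0 < r)
    {y : ℕ → ℝ} (h : ∀ k, |y k| ≤ M * r ^ k) : Summable fun k => a k * y k := by
  refine Summable.of_norm_bounded ((ha r hr).mul_left M) fun k => ?_
  rw [Real.norm_eq_abs, abs_mul]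
  calc |a k| * |y k| ≤ |a k| * (M * r ^ k) := by gcongr; exact h k
    _ = _ := by ring

theorem RapidDecay.summable_legQ {a : ℕ → ℝ} (ha : RapidDecay a) {t : ℝ} (ht : t ∈ Ioo (-1 : ℝ) 1) :
    Summable fun k => a k * legQ k t := by
  obtain ⟨M, -, h⟩ := exists_abs_legQ_le (abs_lt.2 ht)
  exact summable_of_geometric_bound ha (by norm_num) (h t le_rfl)

theorem RapidDecay.summable_flux {a : ℕ → ℝ} (ha : RapidDecay a) {t : ℝ} (ht : t ∈ Ioo (-1 : ℝ) 1) :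
    Summable fun k => a k * legFlux legQ 1 k t := by
  obtain ⟨M, -, h⟩ := exists_abs_flux_legQ_le (abs_lt.2 ht)
  exact summable_of_geometric_bound ha (by norm_num) (h t le_rfl)

theorem one_sub_sq_pos {t : ℝ} (ht : t ∈ Ioo (-1 : ℝ) 1) : 0 < 1 - t ^ 2 := by
  nlinarith [ht.1, ht.2]

theorem hasDerivAt_legQ (k : ℕ) {t : ℝ} (ht : t ∈ Ioo (-1 : ℝ) 1) :
    HasDerivAt (legQ k) (legFlux legQ 1 k t / (1 - t ^ 2)) t := by
  obtain ⟨d, hd, e⟩ := legSeq_legQ.hasDerivAt k ht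
  rwa [← e, mul_div_cancel_left₀ _ (one_sub_sq_pos ht).ne']

/-- Termwise differentiation is legitimate on `(-r, r)` with `|t| < r < 1`: there the flux bound is
uniform and `1 - s² ≥ 1 - r²`. -/
theorem RapidDecay.hasDerivAt_legQSum {a : ℕ → ℝ} (ha : RapidDecay a) {t : ℝ}
    (ht : t ∈ Ioo (-1 : ℝ) 1) :
    HasDerivAt (legQSum a) (legQFluxSum a t / (1 - t ^ 2)) t := by
  obtain ⟨r, htr, hr⟩ := exists_between (abs_lt.2 ht)
  have hr0 : 0 < r := (abs_nonneg t).trans_lt htr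
  obtain ⟨M, hM, h⟩ := exists_abs_flux_legQ_le hr
  have hsub : ∀ s ∈ Ioo (-r) r, s ∈ Ioo (-1 : ℝ) 1 := fun s hs =>
    ⟨by linarith [hs.1], by linarith [hs.2]⟩
  have key := hasDerivAt_tsum_of_isPreconnected (t := Ioo (-r) r)
    (g := fun k s => a k * legQ k s)
    (g' := fun k s => a k * (legFlux legQ 1 k s / (1 - s ^ 2)))
    (u := fun k => |a k| * 6 ^ k * (M / (1 - r ^ 2))) (y₀ := t) (y := t)
    ((ha 6 (by norm_num)).mul_right _) isOpen_Ioo isPreconnected_Ioo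
    (fun k s hs => (hasDerivAt_legQ k (hsub s hs)).const_mul (a k))
    (fun k s hs => ?_) (abs_lt.1 htr) (ha.summable_legQ ht) (abs_lt.1 htr)
  · refine key.congr_deriv ?_
    rw [legQFluxSum, ← tsum_div_const]
    simp only [mul_div_assoc]
  · have hs' : |s| ≤ r := (abs_lt.2 hs).le
    have h1 : 0 < 1 - r ^ 2 := by nlinarith
    have h2 : 1 - r ^ 2 ≤ 1 - s ^ 2 := by nlinarith [hs.1, hs.2]
    rw [Real.norm_eq_abs, abs_mul, abs_div, abs_of_pos (one_sub_sq_pos (hsub s hs)), mul_assoc]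
    gcongr
    rw [mul_div_assoc', mul_comm (6 ^ k)]
    gcongr
    exact h s hs' k

theorem RapidDecay.hasDerivAt_legQFluxSum {a : ℕ → ℝ} (ha : RapidDecay a) {t : ℝ}
    (ht : t ∈ Ioo (-1 : ℝ) 1) :
    HasDerivAt (legQFluxSum a) (-legQSum (fun k => (k : ℝ) * ((k : ℝ) + 1) * a k) t) t := by
  obtain ⟨r, htr, hr⟩ := exists_between (abs_lt.2 ht)
  obtain ⟨M, hM, h⟩ := exists_abs_legQ_le hr
  have hsub : ∀ s ∈ Ioo (-r) r, s ∈ Ioo (-1 : ℝ) 1 := fun s hs =>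
    ⟨by linarith [hs.1], by linarith [hs.2]⟩
  have key := hasDerivAt_tsum_of_isPreconnected (t := Ioo (-r) r)
    (g := fun k s => a k * legFlux legQ 1 k s)
    (g' := fun (k : ℕ) s => a k * (-((k : ℝ) * ((k : ℝ) + 1)) * legQ k s))
    (u := fun k : ℕ => |(k : ℝ) * ((k : ℝ) + 1) * a k| * 3 ^ k * M) (y₀ := t) (y := t)
    ((ha.eigen_mul 3 (by norm_num)).mul_right _) isOpen_Ioo isPreconnected_Ioo
    (fun k s hs => (legSeq_legQ.hasDerivAt_flux k (hsub s hs)).const_mul (a k))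
    (fun k s hs => ?_) (abs_lt.1 htr) (ha.summable_flux ht) (abs_lt.1 htr)
  · refine key.congr_deriv ?_
    rw [legQSum, ← tsum_neg]
    exact tsum_congr fun k => by ring
  · have hs' : |s| ≤ r := (abs_lt.2 hs).le
    rw [show a k * (-((k : ℝ) * ((k : ℝ) + 1)) * legQ k s)
      = -((k : ℝ) * ((k : ℝ) + 1) * a k) * legQ k s by ring, Real.norm_eq_abs, abs_mul, abs_neg]
    exact (mul_le_mul_of_nonneg_left (h s hs' k) (abs_nonneg _)).trans_eq (by ring)

/-- The sum and the flux sum differentiate into each other, up to the factor `1 - t²` and the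
replacement of `a_k` by `k(k+1) a_k`. Rapid decay is preserved, so the induction runs over all
sequences at once. -/
theorem RapidDecay.contDiffOn_aux (n : ℕ) : ∀ {a : ℕ → ℝ}, RapidDecay a →
    ContDiffOn ℝ n (legQSum a) (Ioo (-1) 1) ∧ ContDiffOn ℝ n (legQFluxSum a) (Ioo (-1) 1) := by
  induction n with
  | zero =>
    intro a ha
    simp only [Nat.cast_zero, contDiffOn_zero]
    exact ⟨fun t ht => (ha.hasDerivAt_legQSum ht).continuousAt.continuousWithinAt,
      fun t ht => (ha.hasDerivAt_legQFluxSum ht).continuousAt.continuousWithinAt⟩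
  | succ n ih =>
    intro a ha
    have hden : ContDiffOn ℝ n (fun t : ℝ => 1 - t ^ 2) (Ioo (-1) 1) := by fun_prop
    constructor
    · push_cast
      rw [contDiffOn_succ_iff_deriv_of_isOpen isOpen_Ioo]
      refine ⟨fun t ht => (ha.hasDerivAt_legQSum ht).differentiableAt.differentiableWithinAt,
        by simp, ?_⟩
      exact ((ih ha).2.div hden fun t ht => (one_sub_sq_pos ht).ne').congr
        fun t ht => (ha.hasDerivAt_legQSum ht).deriv
    · push_cast
      rw [contDiffOn_succ_iff_deriv_of_isOpen isOpen_Ioo]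
      refine ⟨fun t ht => (ha.hasDerivAt_legQFluxSum ht).differentiableAt.differentiableWithinAt,
        by simp, ?_⟩
      exact (ih ha.eigen_mul).1.neg.congr fun t ht => (ha.hasDerivAt_legQFluxSum ht).deriv

theorem RapidDecay.contDiffOn_legQSum {a : ℕ → ℝ} (ha : RapidDecay a) :
    ContDiffOn ℝ ∞ (legQSum a) (Ioo (-1) 1) :=
  contDiffOn_infty.2 fun n => (RapidDecay.contDiffOn_aux n ha).1

/-! ### Multiplication by `x` and the inhomogeneous equation -/

/-- `b` is the Legendre coefficient sequence of `x ↦ x g(x)` when `a` is that of `g`. -/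
structure IsMulXCoeff (a b : ℕ → ℝ) : Prop where
  zero : b 0 = a 1 / 3
  succ : ∀ k : ℕ, b (k + 1) = ((k : ℝ) + 2) / (2 * (k : ℝ) + 5) * a (k + 2)
    + ((k : ℝ) + 1) / (2 * (k : ℝ) + 1) * a k

theorem isMulXCoeff_legCoeff {g : ℝ → ℝ} (hg : IntervalIntegrable g volume (-1) 1) :
    IsMulXCoeff (legCoeff g) (legCoeff fun x => x * g x) where
  zero := by
    simp only [legCoeff, legP]
    rw [show (fun x : ℝ => x * g x * 1) = fun x => g x * x by funext x; ring]
    push_cast; ring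
  succ k := by
    have hi (j : ℕ) : IntervalIntegrable (fun x => g x * legP j x) volume (-1) 1 :=
      hg.mul_continuousOn (continuous_legP j).continuousOn
    have h : ∫ x in (-1 : ℝ)..1, x * g x * legP (k + 1) x
        = ((k : ℝ) + 2) / (2 * (k : ℝ) + 3) * (∫ x in (-1 : ℝ)..1, g x * legP (k + 2) x)
          + ((k : ℝ) + 1) / (2 * (k : ℝ) + 3) * ∫ x in (-1 : ℝ)..1, g x * legP k x := by
      rw [← intervalIntegral.integral_const_mul, ← intervalIntegral.integral_const_mul,
        ← intervalIntegral.integral_add ((hi _).const_mul _) ((hi _).const_mul _)]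
      refine intervalIntegral.integral_congr fun x _ => ?_
      have hr := legRec_legP k x
      have : 2 * (k : ℝ) + 3 ≠ 0 := by positivity
      field_simp
      linear_combination (-g x) * hr
    simp only [legCoeff]
    rw [h]
    push_cast
    field_simp
    ring

theorem IsMulXCoeff.rapidDecay {a b : ℕ → ℝ} (h : IsMulXCoeff a b) (ha : RapidDecay a) :
    RapidDecay b := by
  refine RapidDecay.of_comp_succ ?_
  have hfrac : ∀ x y : ℝ, 0 ≤ x → x ≤ y → |x / y| ≤ 1 := fun x y hx hxy => by
    rw [abs_of_nonneg (div_nonneg hx (hx.trans hxy))]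
    exact div_le_one_of_le₀ hxy (hx.trans hxy)
  have h1 : RapidDecay fun k : ℕ => ((k : ℝ) + 2) / (2 * (k : ℝ) + 5) * a (k + 2) := by
    refine ha.comp_succ.comp_succ.of_pow_mul_le (C := 1) (r := 1) one_pos fun k => ?_
    rw [abs_mul, one_pow, mul_one]
    gcongr
    have hk : (0 : ℝ) ≤ k := by positivity
    exact hfrac _ _ (by positivity) (by linarith)
  have h2 : RapidDecay fun k : ℕ => ((k : ℝ) + 1) / (2 * (k : ℝ) + 1) * a k := by
    refine ha.of_pow_mul_le (C := 1) (r := 1) one_pos fun k => ?_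
    rw [abs_mul, one_pow, mul_one]
    gcongr
    have hk : (0 : ℝ) ≤ k := by positivity
    exact hfrac _ _ (by positivity) (by linarith)
  have := h1.add h2
  simpa only [← h.succ] using this

/-- The recurrence expresses `t Q_k` through `Q_(k+1)` and `Q_(k-1)` for `k ≥ 1`, but `t Q_0 = Q_1 +
1`; the extra `1` leaves `a 0` behind. Below, `u` collects the lowered terms and `v` the raised
ones. -/
theorem IsMulXCoeff.legQSum_eq {a b : ℕ → ℝ} (h : IsMulXCoeff a b) (ha : RapidDecay a) {t : ℝ}
    (ht : t ∈ Ioo (-1 : ℝ) 1) : legQSum b t = t * legQSum a t - a 0 := by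
  set u : ℕ → ℝ := fun k => ((k : ℝ) + 1) / (2 * (k : ℝ) + 3) * a (k + 1) * legQ k t with hu
  set v : ℕ → ℝ := fun k => ((k : ℝ) + 1) / (2 * (k : ℝ) + 1) * a k * legQ (k + 1) t with hv
  have hfrac : ∀ x y : ℝ, 0 ≤ x → x ≤ y → |x / y| ≤ 1 := fun x y hx hxy => by
    rw [abs_of_nonneg (div_nonneg hx (hx.trans hxy))]
    exact div_le_one_of_le₀ hxy (hx.trans hxy)
  have hus : Summable u := by
    refine RapidDecay.summable_legQ (ha.comp_succ.of_pow_mul_le (C := 1) (r := 1) one_pos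
      fun k => ?_) ht
    rw [abs_mul, one_pow, mul_one]
    gcongr
    have hk : (0 : ℝ) ≤ k := by positivity
    exact hfrac _ _ (by positivity) (by linarith)
  have hvs : Summable v := by
    obtain ⟨M, -, hM⟩ := exists_abs_legQ_le (abs_lt.2 ht)
    have h2 : RapidDecay fun k : ℕ => ((k : ℝ) + 1) / (2 * (k : ℝ) + 1) * a k := by
      refine ha.of_pow_mul_le (C := 1) (r := 1) one_pos fun k => ?_
      rw [abs_mul, one_pow, mul_one]
      gcongr
      have hk : (0 : ℝ) ≤ k := by positivity
      exact hfrac _ _ (by positivity) (by linarith)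
    refine summable_of_geometric_bound (M := M * 3) (r := 3) h2 (by norm_num) fun k => ?_
    refine (hM t le_rfl (k + 1)).trans_eq ?_
    ring
  have hb : legQSum b t = ∑' k, u k + ∑' k, v k := by
    rw [legQSum, ((h.rapidDecay ha).summable_legQ ht).tsum_eq_zero_add, hus.tsum_eq_zero_add,
      add_assoc, ← ((summable_nat_add_iff 1).2 hus).tsum_add hvs]
    congr 1
    · simp only [hu, h.zero]; push_cast; ring
    · refine tsum_congr fun k => ?_
      simp only [hu, hv, h.succ]; push_cast; ring
  have hq : t * legQSum a t = a 0 + (∑' k, v k + ∑' k, u k) := by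
    rw [legQSum, (ha.summable_legQ ht).tsum_eq_zero_add, hvs.tsum_eq_zero_add, mul_add,
      ← tsum_mul_left, add_assoc (v 0), ← ((summable_nat_add_iff 1).2 hvs).tsum_add hus,
      ← add_assoc]
    congr 1
    · simp only [hv, legQ]; push_cast; ring
    · refine tsum_congr fun k => ?_
      have hr := legRec_legQ k t
      have hk : 2 * (k : ℝ) + 3 ≠ 0 := by positivity
      have hk' : 2 * ((k : ℝ) + 1) + 1 ≠ 0 := by positivity
      simp only [hu, hv]; push_cast
      rw [show 2 * ((k : ℝ) + 1) + 1 = 2 * (k : ℝ) + 3 by ring]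
      field_simp
      linear_combination (-a (k + 1)) * hr
  rw [hb, hq]; ring

theorem tildePhi_eq_legQSum (ψ : ℝ → ℝ) : tildePhi ψ = legQSum (legCoeff ψ) := rfl

/-- The inhomogeneous equation in divergence form. -/
theorem hasDerivAt_legQFluxSum_of_rel {ψ : ℝ → ℝ} {c χ : ℝ} (hα : RapidDecay (legCoeff ψ))
    (hψ : IntervalIntegrable ψ volume (-1) 1)
    (hrel : ∀ k : ℕ, (k : ℝ) * ((k : ℝ) + 1) * legCoeff ψ k
      = χ * legCoeff ψ k - c ^ 2 * legCoeff (fun x => x * (x * ψ x)) k)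
    {t : ℝ} (ht : t ∈ Ioo (-1 : ℝ) 1) :
    HasDerivAt (legQFluxSum (legCoeff ψ)) (-(χ - c ^ 2 * t ^ 2) * legQSum (legCoeff ψ) t
      - c ^ 2 * (legCoeff ψ 0 * t + legCoeff ψ 1 / 3)) t := by
  have h1 := isMulXCoeff_legCoeff hψ
  have h2 := isMulXCoeff_legCoeff (hψ.continuousOn_mul continuousOn_id)
  simp only [id] at h2
  have hb := h1.rapidDecay hα
  refine (hα.hasDerivAt_legQFluxSum ht).congr_deriv ?_
  have e2 := h2.legQSum_eq hb ht
  have e1 := h1.legQSum_eq hα ht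
  have e0 : legQSum (fun k : ℕ => (k : ℝ) * ((k : ℝ) + 1) * legCoeff ψ k) t
      = χ * legQSum (legCoeff ψ) t - c ^ 2 * legQSum (legCoeff fun x => x * (x * ψ x)) t := by
    simp only [hrel]
    simp only [legQSum]
    rw [← tsum_mul_left, ← tsum_mul_left, ← Summable.tsum_sub
      ((hα.summable_legQ ht).mul_left χ) (((h2.rapidDecay hb).summable_legQ ht).mul_left (c ^ 2))]
    exact tsum_congr fun k => by ring
  -- Two multiplications by `x` give `t (t S - α_0) - α_1 / 3`, since the zeroth coefficient of `x
  -- ψ` is `α_1 / 3`.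
  rw [e0, e2, e1, h1.zero]
  ring

/-! ### Repeated differentiation of the equation -/

theorem hasDerivAt_iteratedDeriv {f : ℝ → ℝ} {U : Set ℝ} (hU : IsOpen U)
    (hf : ContDiffOn ℝ ∞ f U) (k : ℕ) {t : ℝ} (ht : t ∈ U) :
    HasDerivAt (iteratedDeriv k f) (iteratedDeriv (k + 1) f t) t := by
  have h : DifferentiableOn ℝ (iteratedDeriv k f) U :=
    (hf.differentiableOn_iteratedDerivWithin (m := k) (by exact_mod_cast WithTop.coe_lt_top _)
      hU.uniqueDiffOn).congr fun s hs => (iteratedDerivWithin_of_isOpen hU hs).symm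
  rw [iteratedDeriv_succ]
  exact (h.differentiableAt (hU.mem_nhds ht)).hasDerivAt

/-- Differentiating the inhomogeneous prolate equation repeatedly. -/
theorem prolate_iteratedDeriv_eqs {f : ℝ → ℝ} {U : Set ℝ} (hU : IsOpen U)
    (hf : ContDiffOn ℝ ∞ f U) {c χ a b : ℝ}
    (h0 : ∀ t ∈ U, (1 - t ^ 2) * iteratedDeriv 2 f t - 2 * t * iteratedDeriv 1 f t
      + (χ - c ^ 2 * t ^ 2) * f t = -c ^ 2 * (a * t + b)) :
    (∀ t ∈ U, (1 - t ^ 2) * iteratedDeriv 3 f t - 4 * t * iteratedDeriv 2 f t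
      + (χ - c ^ 2 * t ^ 2 - 2) * iteratedDeriv 1 f t - 2 * c ^ 2 * t * f t = -c ^ 2 * a) ∧
    ∀ k : ℕ, 2 ≤ k → ∀ t ∈ U, (1 - t ^ 2) * iteratedDeriv (k + 2) f t
      - 2 * ((k : ℝ) + 1) * t * iteratedDeriv (k + 1) f t
      + (χ - (k : ℝ) * ((k : ℝ) + 1) - c ^ 2 * t ^ 2) * iteratedDeriv k f t
      - 2 * c ^ 2 * (k : ℝ) * t * iteratedDeriv (k - 1) f t
      - c ^ 2 * (k : ℝ) * ((k : ℝ) - 1) * iteratedDeriv (k - 2) f t = 0 := by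
  have D (k : ℕ) {t : ℝ} (ht : t ∈ U) := hasDerivAt_iteratedDeriv hU hf k ht
  have hsq (t : ℝ) : HasDerivAt (fun s : ℝ => s ^ 2) (2 * t) t := by
    simpa using hasDerivAt_pow 2 t
  have uniq {F G : ℝ → ℝ} {t F' G' : ℝ} (ht : t ∈ U) (hFG : ∀ s ∈ U, F s = G s)
      (hF : HasDerivAt F F' t) (hG : HasDerivAt G G' t) : F' = G' :=
    hF.unique (hG.congr_of_eventuallyEq (Filter.eventually_of_mem (hU.mem_nhds ht) hFG))
  have h1 : ∀ t ∈ U, (1 - t ^ 2) * iteratedDeriv 3 f t - 4 * t * iteratedDeriv 2 f t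
      + (χ - c ^ 2 * t ^ 2 - 2) * iteratedDeriv 1 f t - 2 * c ^ 2 * t * f t = -c ^ 2 * a := by
    intro t ht
    have df : HasDerivAt f (iteratedDeriv 1 f t) t := by simpa using D 0 ht
    have := uniq ht h0 (((((hsq t).const_sub 1).mul (D 2 ht)).sub
      (((hasDerivAt_id t).const_mul 2).mul (D 1 ht))).add
      ((((hsq t).const_mul (c ^ 2)).const_sub χ).mul df))
      ((((hasDerivAt_id t).const_mul a).add_const b).const_mul (-c ^ 2))
    simp only [id] at this
    linear_combination this
  -- The right side is affine in `t`, so this second differentiation removes it; the result is the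
  -- general equation at `k = 2`.
  have h2 : ∀ t ∈ U, (1 - t ^ 2) * iteratedDeriv 4 f t - 6 * t * iteratedDeriv 3 f t
      + (χ - 6 - c ^ 2 * t ^ 2) * iteratedDeriv 2 f t - 4 * c ^ 2 * t * iteratedDeriv 1 f t
      - 2 * c ^ 2 * f t = 0 := by
    intro t ht
    have df : HasDerivAt f (iteratedDeriv 1 f t) t := by simpa using D 0 ht
    have := uniq ht h1 ((((((hsq t).const_sub 1).mul (D 3 ht)).sub
      (((hasDerivAt_id t).const_mul 4).mul (D 2 ht))).add
      (((((hsq t).const_mul (c ^ 2)).const_sub χ).sub_const 2).mul (D 1 ht))).sub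
      (((hasDerivAt_id t).const_mul (2 * c ^ 2)).mul df))
      (hasDerivAt_const t (-c ^ 2 * a))
    simp only [id] at this
    linear_combination this
  refine ⟨h1, fun k hk => ?_⟩
  induction k, hk using Nat.le_induction with
  | base =>
    intro t ht
    have := h2 t ht
    simp only [Nat.reduceAdd, Nat.reduceSub, Nat.cast_ofNat, iteratedDeriv_zero]
    linear_combination this
  | succ k hk ih =>
    intro t ht
    -- Writing `k = m + 2` lets the truncated `k - 1` and `k - 2` reduce definitionally.
    obtain ⟨m, rfl⟩ := Nat.exists_eq_add_of_le' hk
    have := uniq ht ih (((((((hsq t).const_sub 1).mul (D (m + 2 + 2) ht)).sub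
      (((hasDerivAt_id t).const_mul (2 * (((m + 2 : ℕ) : ℝ) + 1))).mul (D (m + 2 + 1) ht))).add
      ((((hsq t).const_mul (c ^ 2)).const_sub
        (χ - ((m + 2 : ℕ) : ℝ) * (((m + 2 : ℕ) : ℝ) + 1))).mul (D (m + 2) ht))).sub
      (((hasDerivAt_id t).const_mul (2 * c ^ 2 * ((m + 2 : ℕ) : ℝ))).mul (D (m + 2 - 1) ht))).sub
      ((D (m + 2 - 2) ht).const_mul (c ^ 2 * ((m + 2 : ℕ) : ℝ) * (((m + 2 : ℕ) : ℝ) - 1))))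
      (hasDerivAt_const t (0 : ℝ))
    simp only [id, Nat.add_sub_cancel, show m + 2 - 1 = m + 1 from rfl,
      show m + 2 + 1 - 1 = m + 2 from rfl, show m + 2 + 1 - 2 = m + 1 from rfl,
      show m + 2 + 1 + 2 = m + 2 + 2 + 1 from rfl, show m + 2 + 1 + 1 = m + 2 + 2 from rfl,
      show m + 1 + 1 = m + 2 from rfl] at this ⊢
    push_cast at this ⊢
    linear_combination this

/-- The properties of `tildePhi` that follow from rapid decay and the coefficient relation. -/
theorem tildePhi_eqs_of_rel {ψ : ℝ → ℝ} {c χ : ℝ} (hα : RapidDecay (legCoeff ψ))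
    (hψ : IntervalIntegrable ψ volume (-1) 1)
    (hrel : ∀ k : ℕ, (k : ℝ) * ((k : ℝ) + 1) * legCoeff ψ k
      = χ * legCoeff ψ k - c ^ 2 * legCoeff (fun x => x * (x * ψ x)) k) :
    ∀ t ∈ Ioo (-1 : ℝ) 1, (1 - t ^ 2) * iteratedDeriv 2 (tildePhi ψ) t
      - 2 * t * iteratedDeriv 1 (tildePhi ψ) t + (χ - c ^ 2 * t ^ 2) * tildePhi ψ t
      = -c ^ 2 * (legCoeff ψ 0 * t + legCoeff ψ 1 / 3) := by
  intro t ht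
  rw [tildePhi_eq_legQSum]
  have hd : ∀ s ∈ Ioo (-1 : ℝ) 1, iteratedDeriv 1 (legQSum (legCoeff ψ)) s
      = legQFluxSum (legCoeff ψ) s / (1 - s ^ 2) := fun s hs => by
    rw [iteratedDeriv_one]; exact (hα.hasDerivAt_legQSum hs).deriv
  have h2 := hasDerivAt_iteratedDeriv isOpen_Ioo hα.contDiffOn_legQSum 1 ht
  have hsq : HasDerivAt (fun s : ℝ => 1 - s ^ 2) (-(2 * t)) t := by
    simpa using (hasDerivAt_pow 2 t).const_sub 1
  have h3 := hsq.mul h2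
  have h4 := (hasDerivAt_legQFluxSum_of_rel hα hψ hrel ht).unique
    (h3.congr_of_eventuallyEq (Filter.eventually_of_mem (isOpen_Ioo.mem_nhds ht) fun s hs => by
      simp only [Pi.mul_apply]
      rw [hd s hs, mul_div_cancel₀ _ (one_sub_sq_pos hs).ne']))
  linear_combination -h4

/-! ### Entire eigenfunctions and operators acting on them -/

/-- Entire eigenfunctions of the finite Fourier transform. -/
structure IsBandEig (c : ℝ) (lam : ℂ) (f : ℂ → ℂ) : Prop where
  diff : Differentiable ℂ f
  eig : ∀ z : ℂ, lam * f z = ∫ t in (-1 : ℝ)..1, f t * Complex.exp (Complex.I * c * z * t)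

/-- Differentiation under the integral sign, dominated on the unit ball around `z`. It needs only
integrability of `φ`, so it also yields the entire extension of `ψ_n`. -/
theorem hasDerivAt_bandIntegral (c : ℝ) {φ : ℝ → ℂ} (hφ : IntervalIntegrable φ volume (-1) 1)
    (z : ℂ) : HasDerivAt (fun z : ℂ => ∫ t in (-1 : ℝ)..1, φ t * Complex.exp (Complex.I * c * z * t))
      (∫ t in (-1 : ℝ)..1, φ t * (Complex.I * c * t) * Complex.exp (Complex.I * c * z * t)) z := by
  have hint (w : ℂ) : IntervalIntegrable (fun t : ℝ => φ t * Complex.exp (Complex.I * c * w * t))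
      volume (-1) 1 := hφ.mul_continuousOn (by fun_prop)
  have hint' : IntervalIntegrable
      (fun t : ℝ => φ t * (Complex.I * c * t) * Complex.exp (Complex.I * c * z * t))
      volume (-1) 1 := (hφ.mul_continuousOn (by fun_prop)).mul_continuousOn (by fun_prop)
  have hmeas {g : ℝ → ℂ} (hg : IntervalIntegrable g volume (-1) 1) :
      AEStronglyMeasurable g (volume.restrict (Ι (-1 : ℝ) 1)) := by
    rw [uIoc_of_le (by norm_num)]; exact hg.1.aestronglyMeasurable
  refine (intervalIntegral.hasDerivAt_integral_of_dominated_loc_of_deriv_le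
    (F := fun (z : ℂ) (t : ℝ) => φ t * Complex.exp (Complex.I * c * z * t))
    (F' := fun (z : ℂ) (t : ℝ) => φ t * (Complex.I * c * t) * Complex.exp (Complex.I * c * z * t))
    (bound := fun t => ‖φ t‖ * (|c| * Real.exp (|c| * (‖z‖ + 1))))
    (Metric.ball_mem_nhds z one_pos) (Filter.Eventually.of_forall fun w =>
      hmeas (hint w)) (hint z) (hmeas hint')
    (Filter.Eventually.of_forall fun t ht w hw => ?_) (hφ.norm.mul_const _)
    (Filter.Eventually.of_forall fun t ht w hw => ?_)).2
  · rw [uIoc_of_le (by norm_num)] at ht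
    have ht1 : |t| ≤ 1 := abs_le.2 ⟨ht.1.le, ht.2⟩
    have hw1 : ‖w‖ ≤ ‖z‖ + 1 := by
      have h1 : ‖w - z‖ < 1 := by simpa [dist_eq_norm] using hw
      have h2 := norm_sub_norm_le w z
      linarith
    have hc : ‖(c : ℂ)‖ = |c| := by simp
    have htn : ‖(t : ℂ)‖ = |t| := by simp
    rw [norm_mul, norm_mul, mul_assoc]
    gcongr
    · rw [norm_mul, norm_mul, Complex.norm_I, one_mul, hc, htn]
      exact mul_le_of_le_one_right (abs_nonneg _) ht1
    · refine (Complex.norm_exp_le_exp_norm _).trans (Real.exp_le_exp.2 ?_)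
      rw [norm_mul, norm_mul, norm_mul, Complex.norm_I, one_mul, hc, htn]
      calc |c| * ‖w‖ * |t| ≤ |c| * ‖w‖ * 1 := by gcongr
        _ ≤ |c| * (‖z‖ + 1) := by rw [mul_one]; gcongr
  · have h : HasDerivAt (fun x : ℂ => Complex.I * c * x * t) (Complex.I * c * t) w := by
      simpa using ((hasDerivAt_id w).const_mul (Complex.I * (c : ℂ))).mul_const (t : ℂ)
    exact (h.cexp.const_mul (φ t)).congr_deriv (by ring)

namespace IsBandEig

variable {c : ℝ} {lam mu : ℂ} {f g u v : ℂ → ℂ}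

theorem continuous_ofReal (hf : Differentiable ℂ f) : Continuous fun t : ℝ => f t :=
  hf.continuous.comp Complex.continuous_ofReal

theorem deriv_eq (h : IsBandEig c lam f) (z : ℂ) : lam * deriv f z
    = ∫ t in (-1 : ℝ)..1, f t * (Complex.I * c * t) * Complex.exp (Complex.I * c * z * t) := by
  have h1 := hasDerivAt_bandIntegral c
    ((continuous_ofReal h.diff).intervalIntegrable (μ := volume) (-1) 1) z
  have h2 := (h.diff z).hasDerivAt.const_mul lam
  rw [show (fun y => lam * f y) = _ from funext h.eig] at h2
  exact h2.unique h1

theorem deriv_deriv_eq (h : IsBandEig c lam f) (z : ℂ) : lam * deriv (deriv f) z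
    = ∫ t in (-1 : ℝ)..1, f t * (Complex.I * c * t) * (Complex.I * c * t)
      * Complex.exp (Complex.I * c * z * t) := by
  have hc := h.diff.continuous
  have h1 := hasDerivAt_bandIntegral c (φ := fun t : ℝ => f t * (Complex.I * c * t))
    (Continuous.intervalIntegrable (by fun_prop) (-1) 1) z
  have h2 := (h.diff.deriv z).hasDerivAt.const_mul lam
  rw [show (fun y => lam * deriv f y) = _ from funext h.deriv_eq] at h2
  exact h2.unique h1

theorem add (hf : IsBandEig c lam f) (hg : IsBandEig c lam g) :
    IsBandEig c lam fun z => f z + g z where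
  diff := hf.diff.add hg.diff
  eig z := by
    have h1 := hf.diff.continuous
    have h2 := hg.diff.continuous
    simp only [add_mul, mul_add]
    rw [intervalIntegral.integral_add (Continuous.intervalIntegrable (by fun_prop) _ _)
      (Continuous.intervalIntegrable (by fun_prop) _ _), hf.eig, hg.eig]

theorem const_mul (hf : IsBandEig c lam f) (a : ℂ) : IsBandEig c lam fun z => a * f z where
  diff := hf.diff.const_mul a
  eig z := by
    simp only [mul_assoc a]
    rw [intervalIntegral.integral_const_mul, ← hf.eig]; ring

theorem comp_neg (hf : IsBandEig c lam f) : IsBandEig c lam fun z => f (-z) where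
  diff := hf.diff.comp differentiable_neg
  eig z := by
    rw [hf.eig]
    have := intervalIntegral.integral_comp_neg (a := (-1 : ℝ)) (b := 1)
      (fun t : ℝ => f t * Complex.exp (Complex.I * c * (-z) * t))
    rw [neg_neg] at this
    rw [← this]
    refine intervalIntegral.integral_congr fun t _ => ?_
    simp

/-- The prolate differential operator. -/
noncomputable def prolateOp (c : ℝ) (f : ℂ → ℂ) (z : ℂ) : ℂ :=
  (1 - z ^ 2) * deriv (deriv f) z - 2 * z * deriv f z - (c : ℂ) ^ 2 * z ^ 2 * f z

theorem differentiable_prolateOp (hf : Differentiable ℂ f) : Differentiable ℂ (prolateOp c f) := by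
  have h1 := hf.deriv
  have h2 := hf.deriv.deriv
  unfold prolateOp
  fun_prop

theorem hasDerivAt_cexp_mul_ofReal (w : ℂ) (t : ℝ) :
    HasDerivAt (fun t : ℝ => Complex.exp (w * t)) (w * Complex.exp (w * t)) t := by
  have h : HasDerivAt (fun z : ℂ => Complex.exp (w * z)) (w * Complex.exp (w * t)) (t : ℂ) := by
    have := ((hasDerivAt_id (t : ℂ)).const_mul w).cexp
    exact this.congr_deriv (by simp only [id]; ring)
  exact h.comp_ofReal

/-- The prolate differential operator commutes with the finite Fourier transform. -/
theorem prolateOp_eig (h : IsBandEig c lam f) : IsBandEig c lam (prolateOp c f) where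
  diff := differentiable_prolateOp h.diff
  eig z := by
    have hc0 := h.diff.continuous
    have hc1 := h.diff.deriv.continuous
    have hc2 := h.diff.deriv.deriv.continuous
    have hc3 : Continuous fun t : ℝ => prolateOp c f t :=
      (differentiable_prolateOp h.diff).continuous.comp Complex.continuous_ofReal
    set w : ℂ := Complex.I * c * z with hw
    -- Lagrange's identity moves the operator from `f` to the kernel, with no boundary terms because
    -- of `1 - t²`. The kernel `e^{iczt}` gives the same result under the operator in `t` and in
    -- `z`.
    have hder (t : ℝ) : HasDerivAt
        (fun t : ℝ => (1 - (t : ℂ) ^ 2) * (deriv f t * Complex.exp (w * t)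
          - f t * (w * Complex.exp (w * t))))
        (prolateOp c f t * Complex.exp (w * t)
          - f t * (w ^ 2 * (1 - (t : ℂ) ^ 2) - 2 * w * t - (c : ℂ) ^ 2 * t ^ 2)
            * Complex.exp (w * t)) t := by
      have d0 := (h.diff t).hasDerivAt.comp_ofReal
      have d1 := (h.diff.deriv t).hasDerivAt.comp_ofReal
      have de := hasDerivAt_cexp_mul_ofReal w t
      have dq : HasDerivAt (fun t : ℝ => 1 - (t : ℂ) ^ 2) (-(2 * (t : ℂ))) t := by
        have : HasDerivAt (fun t : ℂ => 1 - t ^ 2) (-(2 * (t : ℂ))) (t : ℂ) := by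
          simpa using (hasDerivAt_pow 2 (t : ℂ)).const_sub 1
        exact this.comp_ofReal
      refine (dq.mul ((d1.mul de).sub (d0.mul (de.const_mul w)))).congr_deriv ?_
      simp only [prolateOp, Pi.sub_apply, Pi.mul_apply]
      ring
    have hint := intervalIntegral.integral_eq_sub_of_hasDerivAt (a := -1) (b := 1)
      (fun t _ => hder t) (Continuous.intervalIntegrable (by fun_prop) _ _)
    rw [intervalIntegral.integral_sub (Continuous.intervalIntegrable (by fun_prop) _ _)
      (Continuous.intervalIntegrable (by fun_prop) _ _)] at hint
    have e : lam * prolateOp c f z = ∫ t in (-1 : ℝ)..1,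
        f t * (w ^ 2 * (1 - (t : ℂ) ^ 2) - 2 * w * t - (c : ℂ) ^ 2 * t ^ 2)
          * Complex.exp (w * t) := by
      calc lam * prolateOp c f z = (1 - z ^ 2) * (lam * deriv (deriv f) z)
            - 2 * z * (lam * deriv f z) - (c : ℂ) ^ 2 * z ^ 2 * (lam * f z) := by
              rw [prolateOp]; ring
        _ = _ := by
          rw [h.eig, h.deriv_eq, h.deriv_deriv_eq, ← intervalIntegral.integral_const_mul,
            ← intervalIntegral.integral_const_mul, ← intervalIntegral.integral_const_mul,
            ← intervalIntegral.integral_sub (Continuous.intervalIntegrable (by fun_prop) _ _)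
              (Continuous.intervalIntegrable (by fun_prop) _ _),
            ← intervalIntegral.integral_sub (Continuous.intervalIntegrable (by fun_prop) _ _)
              (Continuous.intervalIntegrable (by fun_prop) _ _)]
          refine intervalIntegral.integral_congr fun t _ => ?_
          simp only [hw]
          linear_combination ((c : ℂ) ^ 2 * (t ^ 2 - z ^ 2) * f t
            * Complex.exp (Complex.I * c * z * t)) * Complex.I_sq
    rw [e]
    push_cast at hint
    linear_combination -hint

/-- The kernel depends only on the product `z t`, so `t d/dt` and `z d/dz` agree on it. Integration
by parts then flips the sign of the symmetrized dilation generator `z d/dz + 1/2`; the boundary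
terms vanish by `h1` and `h2`. -/
theorem euler_eig (h : IsBandEig c lam f) (h1 : f 1 = 0) (h2 : f (-1) = 0) :
    IsBandEig c (-lam) fun z => z * deriv f z + f z / 2 where
  diff := by
    have := h.diff.deriv
    have := h.diff
    fun_prop
  eig z := by
    have hc0 := h.diff.continuous
    have hc1 := h.diff.deriv.continuous
    set w : ℂ := Complex.I * c * z with hw
    have hder (t : ℝ) : HasDerivAt (fun t : ℝ => (t : ℂ) * f t * Complex.exp (w * t))
        ((t * deriv f t + f t / 2) * Complex.exp (w * t)
          + (f t * Complex.exp (w * t) / 2 + z * (f t * (Complex.I * c * t) * Complex.exp (w * t))))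
        t := by
      have d0 := (h.diff t).hasDerivAt.comp_ofReal
      have de := hasDerivAt_cexp_mul_ofReal w t
      have dt : HasDerivAt (fun t : ℝ => (t : ℂ)) 1 t := (hasDerivAt_id (t : ℂ)).comp_ofReal
      refine ((dt.mul d0).mul de).congr_deriv ?_
      simp only [Pi.mul_apply]
      rw [hw]
      ring
    have hint := intervalIntegral.integral_eq_sub_of_hasDerivAt (a := -1) (b := 1)
      (fun t _ => hder t) (Continuous.intervalIntegrable (by fun_prop) _ _)
    rw [intervalIntegral.integral_add (Continuous.intervalIntegrable (by fun_prop) _ _)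
      (Continuous.intervalIntegrable (by fun_prop) _ _),
      intervalIntegral.integral_add (Continuous.intervalIntegrable (by fun_prop) _ _)
      (Continuous.intervalIntegrable (by fun_prop) _ _), intervalIntegral.integral_div,
      intervalIntegral.integral_const_mul, hw, ← h.eig, ← h.deriv_eq] at hint
    push_cast at hint
    rw [h1, h2] at hint
    rw [hw]
    linear_combination -hint

theorem integral_swap (c : ℝ) {p q : ℝ → ℂ} (hp : Continuous p) (hq : Continuous q) :
    ∫ x in (-1 : ℝ)..1, p x * ∫ t in (-1 : ℝ)..1, q t * Complex.exp (Complex.I * c * x * t)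
      = ∫ t in (-1 : ℝ)..1, q t * ∫ x in (-1 : ℝ)..1, p x * Complex.exp (Complex.I * c * t * x) := by
  simp only [← intervalIntegral.integral_const_mul]
  simp only [intervalIntegral.integral_of_le (show (-1 : ℝ) ≤ 1 by norm_num)]
  rw [integral_integral_swap]
  · refine integral_congr_ae (Filter.Eventually.of_forall fun t => ?_)
    refine integral_congr_ae (Filter.Eventually.of_forall fun x => ?_)
    simp only
    rw [show Complex.I * c * t * x = Complex.I * c * x * t by ring]
    ring
  · rw [Measure.prod_restrict]
    have : Continuous (Function.uncurry fun x t : ℝ =>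
        p x * (q t * Complex.exp (Complex.I * c * x * t))) := by
      unfold Function.uncurry
      fun_prop
    exact (this.continuousOn.integrableOn_compact (isCompact_Icc.prod isCompact_Icc)).mono_set
      (Set.prod_mono Ioc_subset_Icc_self Ioc_subset_Icc_self)

/-- The kernel is symmetric, so `F_c` is symmetric for the bilinear pairing without conjugation. -/
theorem integral_mul_comm (hu : IsBandEig c lam u) (hv : IsBandEig c mu v) :
    lam * ∫ x in (-1 : ℝ)..1, u x * v x = mu * ∫ x in (-1 : ℝ)..1, u x * v x := by
  have h := integral_swap c (continuous_ofReal hv.diff) (continuous_ofReal hu.diff)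
  simp only [← hu.eig, ← hv.eig] at h
  simp only [show ∀ x : ℝ, v x * (lam * u x) = lam * (u x * v x) from fun x => by ring,
    show ∀ x : ℝ, u x * (mu * v x) = mu * (u x * v x) from fun x => by ring,
    intervalIntegral.integral_const_mul] at h
  exact h

theorem integral_euler_comm (hu : IsBandEig c lam u) (hv : IsBandEig c mu v) :
    lam * ∫ x in (-1 : ℝ)..1, x * deriv u x * v x = mu * ∫ x in (-1 : ℝ)..1, x * u x * deriv v x := by
  have hcu := hu.diff.continuous
  have hcv := hv.diff.continuous
  have h := integral_swap c (p := fun x : ℝ => x * v x) (q := fun t : ℝ => u t * (Complex.I * c * t))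
    (by fun_prop) (by fun_prop)
  simp only [← hu.deriv_eq] at h
  have e (t : ℝ) : (u t * (Complex.I * c * t)) * ∫ x in (-1 : ℝ)..1,
      (x * v x) * Complex.exp (Complex.I * c * t * x) = u t * t * (mu * deriv v t) := by
    rw [hv.deriv_eq, ← intervalIntegral.integral_const_mul, ← intervalIntegral.integral_const_mul]
    refine intervalIntegral.integral_congr fun x _ => ?_
    ring
  simp only [e] at h
  simp only [show ∀ x : ℝ, x * v x * (lam * deriv u x) = lam * (x * deriv u x * v x) from
      fun x => by ring,
    show ∀ x : ℝ, u x * x * (mu * deriv v x) = mu * (x * u x * deriv v x) from fun x => by ring,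
    intervalIntegral.integral_const_mul] at h
  exact h

/-- The left side is `∫ (x u v)'`. Opposite eigenvalues make `∫ u v` vanish and make the other two
terms cancel, by `integral_mul_comm` and `integral_euler_comm`. -/
theorem boundary_eq_zero (hlam : lam ≠ 0) (hu : IsBandEig c lam u) (hv : IsBandEig c (-lam) v) :
    u 1 * v 1 + u (-1) * v (-1) = 0 := by
  have hcu := hu.diff.continuous
  have hcv := hv.diff.continuous
  have hcu' := hu.diff.deriv.continuous
  have hcv' := hv.diff.deriv.continuous
  have h0 : ∫ x in (-1 : ℝ)..1, u x * v x = 0 := by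
    have h := integral_mul_comm hu hv
    have h' : (2 * lam) * ∫ x in (-1 : ℝ)..1, u x * v x = 0 := by linear_combination h
    exact (mul_eq_zero.1 h').resolve_left (mul_ne_zero two_ne_zero hlam)
  have h1 : (∫ x in (-1 : ℝ)..1, x * deriv u x * v x) + ∫ x in (-1 : ℝ)..1, x * u x * deriv v x
      = 0 := by
    have h := integral_euler_comm hu hv
    refine (mul_eq_zero.1 (?_ : lam * _ = 0)).resolve_left hlam
    linear_combination h
  have hder (t : ℝ) : HasDerivAt (fun t : ℝ => (t : ℂ) * u t * v t)
      (u t * v t + (t * deriv u t * v t + t * u t * deriv v t)) t := by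
    have d0 := (hu.diff t).hasDerivAt.comp_ofReal
    have d1 := (hv.diff t).hasDerivAt.comp_ofReal
    have dt : HasDerivAt (fun t : ℝ => (t : ℂ)) 1 t := (hasDerivAt_id (t : ℂ)).comp_ofReal
    refine ((dt.mul d0).mul d1).congr_deriv ?_
    simp only [Pi.mul_apply]
    ring
  have hint := intervalIntegral.integral_eq_sub_of_hasDerivAt (a := -1) (b := 1)
    (fun t _ => hder t) (Continuous.intervalIntegrable (by fun_prop) _ _)
  rw [intervalIntegral.integral_add (Continuous.intervalIntegrable (by fun_prop) _ _)
    (Continuous.intervalIntegrable (by fun_prop) _ _),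
    intervalIntegral.integral_add (Continuous.intervalIntegrable (by fun_prop) _ _)
    (Continuous.intervalIntegrable (by fun_prop) _ _), h0, h1] at hint
  push_cast at hint
  linear_combination -hint

end IsBandEig

/-! ### Eigenspaces of fixed parity are lines -/

namespace IsBandEig

variable {c : ℝ} {lam mu : ℂ} {f g u v : ℂ → ℂ} {e : ℂ}

theorem deriv_neg_of_parity (hp : ∀ z, f (-z) = e * f z) (z : ℂ) :
    deriv f (-z) = -(e * deriv f z) := by
  have h : deriv (fun z => f (-z)) z = deriv (fun z => e * f z) z := by simp only [hp]
  rw [deriv_comp_neg, deriv_const_mul_field] at h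
  linear_combination -h

theorem prolateOp_parity (hp : ∀ z, f (-z) = e * f z) (z : ℂ) :
    prolateOp c f (-z) = e * prolateOp c f z := by
  have h1 := deriv_neg_of_parity hp
  have h2 : ∀ z, deriv f (-z) = (-e) * deriv f z := fun z => by rw [h1]; ring
  have h3 := deriv_neg_of_parity h2
  simp only [prolateOp, h1, h3, hp]
  ring

theorem euler_parity (hp : ∀ z, f (-z) = e * f z) (z : ℂ) :
    -z * deriv f (-z) + f (-z) / 2 = e * (z * deriv f z + f z / 2) := by
  rw [deriv_neg_of_parity hp, hp]; ring

/-- At `1` the prolate operator lowers the order of vanishing by exactly one. -/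
theorem prolateOp_factor (m : ℕ) (hg : AnalyticAt ℂ g 1)
    (hfg : f =ᶠ[nhds 1] fun z => (z - 1) ^ (m + 1) * g z) :
    ∃ h, AnalyticAt ℂ h 1 ∧ h 1 = -2 * ((m : ℂ) + 1) ^ 2 * g 1 ∧
      prolateOp c f =ᶠ[nhds 1] fun z => (z - 1) ^ m * h z := by
  have hg1 := hg.deriv
  have hg2 := hg1.deriv
  have e1 : deriv f =ᶠ[nhds 1]
      fun z => (z - 1) ^ m * (((m : ℂ) + 1) * g z + (z - 1) * deriv g z) := by
    refine hfg.deriv.trans ?_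
    filter_upwards [hg.eventually_analyticAt] with z hz
    have := ((((hasDerivAt_id z).sub_const 1).pow (m + 1)).mul
      hz.differentiableAt.hasDerivAt).deriv
    simp only [id, Nat.add_sub_cancel] at this
    refine Eq.trans ?_ (this.trans ?_)
    · rfl
    · simp only [Pi.pow_apply]; push_cast; ring
  -- Since `1 - z² = -(z + 1)(z - 1)`, only `(z - 1) f''` is needed; this avoids the exponent `m -
  -- 1`.
  have e2 : (fun z => (z - 1) * deriv (deriv f) z) =ᶠ[nhds 1]
      fun z => (z - 1) ^ m * ((m : ℂ) * (((m : ℂ) + 1) * g z + (z - 1) * deriv g z)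
        + (z - 1) * (((m : ℂ) + 2) * deriv g z + (z - 1) * deriv (deriv g) z)) := by
    filter_upwards [e1.deriv, hg.eventually_analyticAt] with z hz hgz
    rw [hz]
    have d0 := hgz.differentiableAt.hasDerivAt
    have d1 := hgz.deriv.differentiableAt.hasDerivAt
    have did := (hasDerivAt_id z).sub_const 1
    have := ((did.pow m).mul ((d0.const_mul ((m : ℂ) + 1)).add (did.mul d1))).deriv
    simp only [id] at this
    have this' : deriv (fun z => (z - 1) ^ m * (((m : ℂ) + 1) * g z + (z - 1) * deriv g z)) z = _ :=
      Eq.trans (by rfl) this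
    rw [this']
    simp only [Pi.pow_apply, Pi.add_apply, Pi.mul_apply]
    rcases m with _ | m
    · simp only [Nat.cast_zero, pow_zero]; ring
    · simp only [Nat.add_sub_cancel]; push_cast; ring
  refine ⟨fun z => -(z + 1) * ((m : ℂ) * (((m : ℂ) + 1) * g z + (z - 1) * deriv g z)
        + (z - 1) * (((m : ℂ) + 2) * deriv g z + (z - 1) * deriv (deriv g) z))
      - 2 * z * (((m : ℂ) + 1) * g z + (z - 1) * deriv g z)
      - (c : ℂ) ^ 2 * z ^ 2 * ((z - 1) * g z), by fun_prop, by ring, ?_⟩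
  filter_upwards [hfg, e1, e2] with z h0 h1 h2
  rw [prolateOp, h1, h0]
  linear_combination (-(z + 1)) * h2

theorem exists_ne_zero_at_one_aux (m : ℕ) : ∀ f : ℂ → ℂ, IsBandEig c lam f →
    (∀ z, f (-z) = e * f z) → (∃ g, AnalyticAt ℂ g 1 ∧ g 1 ≠ 0 ∧
      f =ᶠ[nhds 1] fun z => (z - 1) ^ m * g z) →
    ∃ h, IsBandEig c lam h ∧ (∀ z, h (-z) = e * h z) ∧ h 1 ≠ 0 := by
  induction m with
  | zero =>
    rintro f hf hp ⟨g, -, hg, hfg⟩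
    refine ⟨f, hf, hp, ?_⟩
    rw [hfg.eq_of_nhds]
    simpa using hg
  | succ m ih =>
    rintro f hf hp ⟨g, hga, hg, hfg⟩
    obtain ⟨h, ha, h1, hh⟩ := prolateOp_factor (c := c) m hga hfg
    refine ih _ hf.prolateOp_eig (prolateOp_parity hp) ⟨h, ha, ?_, hh⟩
    rw [h1]
    have : (m : ℂ) + 1 ≠ 0 := by exact_mod_cast Nat.succ_ne_zero m
    exact mul_ne_zero (mul_ne_zero (by norm_num) (pow_ne_zero 2 this)) hg

theorem exists_ne_zero_at_one (hf : IsBandEig c lam f) (hp : ∀ z, f (-z) = e * f z)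
    (hne : f ≠ 0) : ∃ h, IsBandEig c lam h ∧ (∀ z, h (-z) = e * h z) ∧ h 1 ≠ 0 := by
  have hnot : ¬∀ᶠ z in nhds (1 : ℂ), f z = 0 := fun h => hne <|
    AnalyticOnNhd.eq_of_eventuallyEq (fun z _ => hf.diff.analyticAt z)
      (fun z _ => analyticAt_const (v := (0 : ℂ))) h
  obtain ⟨m, g, hga, hg, hfg⟩ := (hf.diff.analyticAt 1).exists_eventuallyEq_pow_smul_nonzero_iff.2
    hnot
  exact exists_ne_zero_at_one_aux m f hf hp ⟨g, hga, hg, hfg⟩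

/-- No nonzero entire function is homogeneous of degree `-1/2`. -/
theorem eq_zero_of_euler (hf : Differentiable ℂ f) (h : ∀ z, z * deriv f z + f z / 2 = 0) :
    f = 0 := by
  have hd : ∀ z, HasDerivAt (fun z => z * f z ^ 2) 0 z := fun z => by
    refine ((hasDerivAt_id z).mul ((hf z).hasDerivAt.pow 2)).congr_deriv ?_
    simp only [id, Pi.pow_apply]
    linear_combination (2 * f z) * h z
  have hconst : ∀ z, z * f z ^ 2 = 0 := fun z => by
    have := is_const_of_deriv_eq_zero (fun z => (hd z).differentiableAt) (fun z => (hd z).deriv) z 0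
    simpa using this
  funext z
  rcases eq_or_ne z 0 with rfl | hz
  · simpa using h 0
  · simpa [hz] using hconst z

/-- A nonzero `f` with `f 1 = 0` would give nonzero eigenfunctions for `lam` and for `-lam` of equal
parity. Powers of the prolate operator make both nonzero at `1`, against `boundary_eq_zero`. -/
theorem eq_zero_of_apply_one (hlam : lam ≠ 0) (he : e ^ 2 = 1) (hf : IsBandEig c lam f)
    (hp : ∀ z, f (-z) = e * f z) (h1 : f 1 = 0) : f = 0 := by
  by_contra hne
  have hv : IsBandEig c (-lam) fun z => z * deriv f z + f z / 2 :=
    hf.euler_eig h1 (by rw [hp, h1, mul_zero])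
  have hv0 : (fun z => z * deriv f z + f z / 2) ≠ 0 := fun h0 =>
    hne (eq_zero_of_euler hf.diff (congrFun h0))
  obtain ⟨u, hu, hup, hu1⟩ := hf.exists_ne_zero_at_one hp hne
  obtain ⟨w, hw, hwp, hw1⟩ := hv.exists_ne_zero_at_one (euler_parity hp) hv0
  have := boundary_eq_zero hlam hu hw
  rw [hup, hwp] at this
  have h2 : 2 * (u 1 * w 1) = 0 := by linear_combination this - (u 1 * w 1) * he
  simp [hu1, hw1] at h2

/-- Eigenspaces of fixed parity are one-dimensional, so they consist of eigenfunctions of the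
prolate differential operator. -/
theorem prolateOp_eq (hlam : lam ≠ 0) (he : e ^ 2 = 1) (hf : IsBandEig c lam f)
    (hp : ∀ z, f (-z) = e * f z) (hne : f ≠ 0) :
    f 1 ≠ 0 ∧ ∃ χ : ℂ, ∀ z, prolateOp c f z = -χ * f z := by
  have h1 : f 1 ≠ 0 := fun h => hne (hf.eq_zero_of_apply_one hlam he hp h)
  refine ⟨h1, -(prolateOp c f 1 / f 1), fun z => ?_⟩
  have hg := hf.prolateOp_eig.add (hf.const_mul (-(prolateOp c f 1 / f 1)))
  have := congrFun (hg.eq_zero_of_apply_one hlam he (fun z => by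
    rw [prolateOp_parity hp, hp]; ring) (by field_simp; ring)) z
  simp only [Pi.zero_apply] at this
  linear_combination this

theorem eq_zero_of_Icc (hlam : lam ≠ 0) (hf : IsBandEig c lam f)
    (h : ∀ x ∈ Icc (-1 : ℝ) 1, f x = 0) : f = 0 := by
  funext z
  have h0 : ∫ t in (-1 : ℝ)..1, f t * Complex.exp (Complex.I * c * z * t) = 0 := by
    rw [intervalIntegral.integral_congr (g := fun _ => (0 : ℂ)) fun t ht => ?_,
      intervalIntegral.integral_zero]
    rw [uIcc_of_le (by norm_num)] at ht
    simp [h t ht]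
  have := hf.eig z
  rw [h0] at this
  exact (mul_eq_zero.1 this).resolve_left hlam

/-- For `f` real on the interval, conjugating the eigenvalue equation at `x` conjugates the kernel,
which amounts to replacing `x` by `-x`. -/
theorem conj_eq_of_real (hlam : lam ≠ 0) (hf : IsBandEig c lam f) (hp : ∀ z, f (-z) = e * f z)
    (hre : ∀ x ∈ Icc (-1 : ℝ) 1, (starRingEnd ℂ) (f x) = f x) (hne : f ≠ 0) :
    (starRingEnd ℂ) lam = lam * e := by
  obtain ⟨x, hx, hfx⟩ : ∃ x ∈ Icc (-1 : ℝ) 1, f x ≠ 0 := by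
    by_contra! h; exact hne (hf.eq_zero_of_Icc hlam h)
  refine mul_right_cancel₀ hfx ?_
  have h1 := hf.eig x
  have h2 := hf.eig (-x)
  rw [hp] at h2
  have h3 := congrArg (starRingEnd ℂ) h1
  rw [map_mul, hre x hx] at h3
  rw [h3, mul_assoc lam, h2, intervalIntegral.integral_of_le (by norm_num),
    intervalIntegral.integral_of_le (by norm_num), ← integral_conj]
  refine setIntegral_congr_fun measurableSet_Ioc fun t ht => ?_
  simp only [map_mul, hre t (Ioc_subset_Icc_self ht), ← Complex.exp_conj, Complex.conj_I,
    Complex.conj_ofReal]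
  congr 2
  ring

/-- An eigenfunction that is real on `[-1, 1]` is even or odd. -/
theorem exists_parity (hlam : lam ≠ 0) (hf : IsBandEig c lam f)
    (hre : ∀ x ∈ Icc (-1 : ℝ) 1, (starRingEnd ℂ) (f x) = f x) :
    ∃ e : ℂ, e ^ 2 = 1 ∧ ∀ z, f (-z) = e * f z := by
  have hn : ∀ x ∈ Icc (-1 : ℝ) 1, (starRingEnd ℂ) (f (-x)) = f (-x) := fun x hx => by
    have := hre (-x) ⟨by linarith [hx.2], by linarith [hx.1]⟩
    simpa using this
  have hev := hf.add hf.comp_neg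
  have hod := hf.add (hf.comp_neg.const_mul (-1))
  by_cases h0 : (fun z => f z + f (-z)) = 0
  · refine ⟨-1, by norm_num, fun z => ?_⟩
    have := congrFun h0 z
    simp only [Pi.zero_apply] at this
    linear_combination this
  by_cases h1 : (fun z => f z + -1 * f (-z)) = 0
  · refine ⟨1, by norm_num, fun z => ?_⟩
    have := congrFun h1 z
    simp only [Pi.zero_apply] at this
    linear_combination -this
  -- If the even and odd parts were both nonzero, `lam` would be both real and purely imaginary.
  have c0 := hev.conj_eq_of_real (e := 1) hlam (fun z => by rw [neg_neg]; ring)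
    (fun x hx => by rw [map_add, hre x hx, hn x hx]) h0
  have c1 := hod.conj_eq_of_real (e := -1) hlam (fun z => by rw [neg_neg]; ring)
    (fun x hx => by rw [map_add, map_mul, hre x hx, hn x hx]; simp) h1
  exact absurd (show lam = 0 by linear_combination (c1 - c0) / 2) hlam

end IsBandEig

/-! ### Nonzero eigenvalues and the regular extension of `ψ_n` -/

theorem intervalIntegrable_of_memLp_volIcc {ψ : ℝ → ℝ} (h : MemLp ψ 2 volIcc) :
    IntervalIntegrable ψ volume (-1) 1 := by
  rw [intervalIntegrable_iff_integrableOn_Icc_of_le (by norm_num)]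
  exact h.integrable (by norm_num)

/-- A function orthogonal to all powers on `[-1, 1]` vanishes almost everywhere there. -/
theorem ae_eq_zero_of_integral_pow {ψ : ℝ → ℝ} (h : IntervalIntegrable ψ volume (-1) 1)
    (hm : ∀ k : ℕ, ∫ t in (-1 : ℝ)..1, ψ t * t ^ k = 0) : ∀ᵐ x ∂volIcc, ψ x = 0 := by
  have hle : (-1 : ℝ) ≤ 1 := by norm_num
  have hI : Integrable ψ volIcc :=
    (intervalIntegrable_iff_integrableOn_Icc_of_le hle).1 h
  have hpoly (p : Polynomial ℝ) : ∫ t in (-1 : ℝ)..1, ψ t * p.eval t = 0 := by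
    simp only [Polynomial.eval_eq_sum_range, Finset.mul_sum]
    rw [intervalIntegral.integral_finsetSum fun i _ => h.mul_continuousOn (by fun_prop)]
    refine Finset.sum_eq_zero fun i _ => ?_
    simp only [mul_left_comm (ψ _)]
    rw [intervalIntegral.integral_const_mul, hm, mul_zero]
  refine ae_eq_zero_of_integral_contDiff_smul_eq_zero hI.locallyIntegrable fun g hg _ => ?_
  have hgc := hg.continuous
  rw [integral_Icc_eq_integral_Ioc, ← intervalIntegral.integral_of_le hle]
  simp only [smul_eq_mul, mul_comm (g _)]
  have hM : 0 ≤ ∫ t in (-1 : ℝ)..1, ‖ψ t‖ :=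
    intervalIntegral.integral_nonneg hle fun t _ => norm_nonneg _
  refine norm_le_zero_iff.1 (le_of_forall_pos_le_add fun ε hε => ?_)
  set M := ∫ t in (-1 : ℝ)..1, ‖ψ t‖ with hMdef
  have hMp : 0 < M + 1 := by linarith
  -- Weierstrass approximation of the test function; `M + 1` keeps the tolerance meaningful when `M
  -- = 0`.
  obtain ⟨p, hp⟩ := exists_polynomial_near_of_continuousOn (-1) 1 g hgc.continuousOn
    (ε / (M + 1)) (div_pos hε hMp)
  have e : ∫ t in (-1 : ℝ)..1, ψ t * g t = ∫ t in (-1 : ℝ)..1, ψ t * (g t - p.eval t) := by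
    simp only [mul_sub]
    rw [intervalIntegral.integral_sub (h.mul_continuousOn hgc.continuousOn)
      (h.mul_continuousOn p.continuous.continuousOn), hpoly, sub_zero]
  rw [e, zero_add]
  calc ‖∫ t in (-1 : ℝ)..1, ψ t * (g t - p.eval t)‖
      ≤ ∫ t in (-1 : ℝ)..1, ‖ψ t‖ * (ε / (M + 1)) :=
        intervalIntegral.norm_integral_le_of_norm_le hle
          (Filter.Eventually.of_forall fun t ht => by
            rw [norm_mul, Real.norm_eq_abs (g t - _), abs_sub_comm]
            gcongr
            exact (hp t (Ioc_subset_Icc_self ht)).le) (h.norm.mul_const _)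
    _ = M / (M + 1) * ε := by rw [intervalIntegral.integral_mul_const]; ring
    _ ≤ 1 * ε := by gcongr; exact div_le_one_of_le₀ (by linarith) hMp.le
    _ = ε := one_mul ε

/-- The finite Fourier transform is injective. -/
theorem ae_eq_zero_of_prolateF_eq_zero {c : ℝ} (hc : c ≠ 0) {ψ : ℝ → ℝ}
    (h : IntervalIntegrable ψ volume (-1) 1)
    (h0 : ∀ x ∈ Icc (-1 : ℝ) 1, prolateF c (fun t => (ψ t : ℂ)) x = 0) :
    ∀ᵐ x ∂volIcc, ψ x = 0 := by
  have hC : IntervalIntegrable (fun t => (ψ t : ℂ)) volume (-1) 1 := ⟨h.1.ofReal, h.2.ofReal⟩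
  -- All `x`-derivatives of the transform vanish on the open interval; at `x = 0` they are multiples
  -- of the moments of `ψ`.
  have hn (k : ℕ) : ∀ x ∈ Ioo (-1 : ℝ) 1, ∫ t in (-1 : ℝ)..1,
      (ψ t * (Complex.I * c * t) ^ k) * Complex.exp (Complex.I * c * (x : ℂ) * t) = 0 := by
    induction k with
    | zero => intro x hx; simpa [prolateF] using h0 x (Ioo_subset_Icc_self hx)
    | succ k ih =>
      intro x hx
      have hd := (hasDerivAt_bandIntegral c
        (φ := fun t => (ψ t : ℂ) * (Complex.I * c * t) ^ k)
        (hC.mul_continuousOn (by fun_prop)) x).comp_ofReal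
      have hz := (hasDerivAt_const x (0 : ℂ)).congr_of_eventuallyEq
        (Filter.eventually_of_mem (isOpen_Ioo.mem_nhds hx) ih)
      rw [← hd.unique hz]
      refine intervalIntegral.integral_congr fun t _ => ?_
      simp only [pow_succ, mul_assoc]
  refine ae_eq_zero_of_integral_pow h fun k => ?_
  have hk := hn k 0 ⟨by norm_num, by norm_num⟩
  have e : ∀ t : ℝ, ((ψ t : ℂ) * (Complex.I * c * t) ^ k)
      * Complex.exp (Complex.I * c * ((0 : ℝ) : ℂ) * t)
      = (Complex.I * c) ^ k * ((ψ t * t ^ k : ℝ) : ℂ) := fun t => by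
    push_cast; rw [mul_pow (Complex.I * c)]; simp; ring
  simp only [e] at hk
  rw [intervalIntegral.integral_const_mul, intervalIntegral.integral_ofReal] at hk
  have hne : (Complex.I * (c : ℂ)) ^ k ≠ 0 :=
    pow_ne_zero k (mul_ne_zero Complex.I_ne_zero (by exact_mod_cast hc))
  exact_mod_cast (mul_eq_zero.1 hk).resolve_left hne

theorem IsPSWFSystem.lam_ne_zero {c : ℝ} (hc : c ≠ 0) {lam : ℕ → ℂ} {ψ : ℕ → ℝ → ℝ}
    (h : IsPSWFSystem c lam ψ) (n : ℕ) : lam n ≠ 0 := by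
  intro h0
  have hz := ae_eq_zero_of_prolateF_eq_zero hc (intervalIntegrable_of_memLp_volIcc (h.memLp n))
    fun x hx => by rw [← h.eigen n x hx, h0, zero_mul]
  have h1 := h.norm_one n
  rw [intervalIntegral.integral_of_le (by norm_num), ← integral_Icc_eq_integral_Ioc,
    integral_congr_ae (g := fun _ => (0 : ℝ)) (hz.mono fun x hx => by simp [hx])] at h1
  simp at h1

/-- Divided by `lam n ≠ 0`, the eigenvalue equation is itself a formula for the entire extension. -/
theorem IsPSWFSystem.exists_isBandEig {c : ℝ} (hc : c ≠ 0) {lam : ℕ → ℂ} {ψ : ℕ → ℝ → ℝ}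
    (h : IsPSWFSystem c lam ψ) (n : ℕ) :
    ∃ f : ℂ → ℂ, IsBandEig c (lam n) f ∧ ∀ x ∈ Icc (-1 : ℝ) 1, f x = ψ n x := by
  have hi := intervalIntegrable_of_memLp_volIcc (h.memLp n)
  have hC : IntervalIntegrable (fun t => (ψ n t : ℂ)) volume (-1) 1 := ⟨hi.1.ofReal, hi.2.ofReal⟩
  have hl := h.lam_ne_zero hc n
  set f : ℂ → ℂ := fun z => (lam n)⁻¹ *
    ∫ t in (-1 : ℝ)..1, (ψ n t : ℂ) * Complex.exp (Complex.I * c * z * t) with hf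
  have hfx : ∀ x ∈ Icc (-1 : ℝ) 1, f x = ψ n x := fun x hx => by
    have := h.eigen n x hx
    rw [prolateF] at this
    rw [hf]
    simp only
    rw [← this, inv_mul_cancel_left₀ hl]
  refine ⟨f, ⟨fun z => ((hasDerivAt_bandIntegral c hC z).differentiableAt).const_mul _,
    fun z => ?_⟩, hfx⟩
  rw [hf]
  simp only
  rw [mul_inv_cancel_left₀ hl]
  refine intervalIntegral.integral_congr fun t ht => ?_
  rw [uIcc_of_le (by norm_num)] at ht
  simp only [← hfx t ht]
  rfl

/-- A twice differentiable extension `ρ` to the line, with derivatives `ρ₁`, `ρ₂`, of a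
solution of the prolate equation on `[-1, 1]` that does not vanish at `1`. -/
structure IsRegularProlate (c χ : ℝ) (ρ ρ₁ ρ₂ : ℝ → ℝ) : Prop where
  hasDerivAt : ∀ x, HasDerivAt ρ (ρ₁ x) x
  hasDerivAt' : ∀ x, HasDerivAt ρ₁ (ρ₂ x) x
  ode : ∀ x ∈ Icc (-1 : ℝ) 1,
    (1 - x ^ 2) * ρ₂ x - 2 * x * ρ₁ x + (χ - c ^ 2 * x ^ 2) * ρ x = 0
  apply_one : ρ 1 ≠ 0

theorem IsPSWFSystem.exists_isRegularProlate {c : ℝ} (hc : c ≠ 0) {lam : ℕ → ℂ} {ψ : ℕ → ℝ → ℝ}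
    (h : IsPSWFSystem c lam ψ) (n : ℕ) : ∃ (χ : ℝ) (ρ ρ₁ ρ₂ : ℝ → ℝ),
      IsRegularProlate c χ ρ ρ₁ ρ₂ ∧ ∀ x ∈ Icc (-1 : ℝ) 1, ψ n x = ρ x := by
  obtain ⟨f, hf, hfx⟩ := h.exists_isBandEig hc n
  have hl := h.lam_ne_zero hc n
  obtain ⟨e, he, hp⟩ := hf.exists_parity hl fun x hx => by rw [hfx x hx, Complex.conj_ofReal]
  have hne : f ≠ 0 := fun h0 => by
    have h1 := h.norm_one n
    rw [intervalIntegral.integral_congr (g := fun _ => (0 : ℝ)) fun t ht => ?_] at h1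
    · simp at h1
    · rw [uIcc_of_le (by norm_num)] at ht
      have := hfx t ht
      rw [h0] at this
      have h2 : ψ n t = 0 := by simpa using this.symm
      simp [h2]
  obtain ⟨h1, χ, hχ⟩ := hf.prolateOp_eq hl he hp hne
  -- As `f` is real on `[-1, 1]`, the real part of the equation involves only the real part of `χ`.
  refine ⟨χ.re, fun x => (f x).re, fun x => (deriv f x).re, fun x => (deriv (deriv f) x).re,
    ⟨fun x => (hf.diff x).hasDerivAt.real_of_complex,
      fun x => (hf.diff.deriv x).hasDerivAt.real_of_complex, fun x hx => ?_, fun h0 => h1 ?_⟩,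
      fun x hx => by simp [hfx x hx]⟩
  · have h2 := congrArg Complex.re (hχ x)
    have h3 : (f x).im = 0 := by rw [hfx x hx, Complex.ofReal_im]
    have e1 : IsBandEig.prolateOp c f x = ((1 - x ^ 2 : ℝ) : ℂ) * deriv (deriv f) x
        - ((2 * x : ℝ) : ℂ) * deriv f x - ((c ^ 2 * x ^ 2 : ℝ) : ℂ) * f x := by
      rw [IsBandEig.prolateOp]; push_cast; ring
    rw [e1, Complex.sub_re, Complex.sub_re, Complex.re_ofReal_mul, Complex.re_ofReal_mul,
      Complex.re_ofReal_mul, Complex.mul_re, h3, Complex.neg_re] at h2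
    linear_combination h2
  · have h2 := hfx 1 ⟨by norm_num, le_rfl⟩
    have h3 : f 1 = ψ n 1 := by simpa using h2
    have h4 : (f 1).re = 0 := by simpa using h0
    rw [h3, Complex.ofReal_re] at h4
    rw [h3, h4, Complex.ofReal_zero]

/-! ### Decay of the Legendre coefficients -/

theorem abs_integral_mul_legP_le {g : ℝ → ℝ} (hg : IntervalIntegrable g volume (-1) 1) {k : ℕ}
    {p : ℕ → ℝ} {ε : ℝ}
    (h : ∀ x ∈ Icc (-1 : ℝ) 1, |g x - ∑ j ∈ Finset.range k, p j * x ^ j| ≤ ε) :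
    |∫ x in (-1 : ℝ)..1, g x * legP k x| ≤ 2 * ε * 3 ^ k := by
  have hP := continuous_legP k
  have e : ∫ x in (-1 : ℝ)..1, g x * legP k x
      = ∫ x in (-1 : ℝ)..1, (g x - ∑ j ∈ Finset.range k, p j * x ^ j) * legP k x := by
    simp only [sub_mul, Finset.sum_mul, mul_assoc]
    rw [intervalIntegral.integral_sub (hg.mul_continuousOn hP.continuousOn)
      (Continuous.intervalIntegrable (by fun_prop) _ _), intervalIntegral.integral_finsetSum
      fun i _ => Continuous.intervalIntegrable (by fun_prop) _ _, Finset.sum_eq_zero, sub_zero]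
    intro j hj
    rw [intervalIntegral.integral_const_mul, integral_pow_mul_legP (Finset.mem_range.1 hj),
      mul_zero]
  rw [e, ← Real.norm_eq_abs]
  refine (intervalIntegral.norm_integral_le_of_norm_le_const (C := ε * 3 ^ k)
    fun x hx => ?_).trans_eq ?_
  · rw [uIoc_of_le (by norm_num)] at hx
    have hx' := Ioc_subset_Icc_self hx
    rw [norm_mul, Real.norm_eq_abs, Real.norm_eq_abs]
    have := h x hx'
    have hε : 0 ≤ ε := (abs_nonneg _).trans this
    gcongr
    exact abs_legP_le (abs_le.2 hx') k
  · norm_num; ring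

/-- Taylor approximation of an eigenfunction of the finite Fourier transform. -/
theorem exists_poly_approx {c : ℝ} {lam : ℂ} (hl : lam ≠ 0) {ψ : ℝ → ℝ}
    (hi : IntervalIntegrable ψ volume (-1) 1)
    (he : ∀ x ∈ Icc (-1 : ℝ) 1, lam * (ψ x : ℂ) = prolateF c (fun t => (ψ t : ℂ)) x)
    {k : ℕ} (hk : |c| / (k.succ : ℝ) ≤ 1 / 2) : ∃ p : ℕ → ℝ, ∀ x ∈ Icc (-1 : ℝ) 1,
      |ψ x - ∑ j ∈ Finset.range k, p j * x ^ j|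
        ≤ ‖lam⁻¹‖ * ((∫ t in (-1 : ℝ)..1, ‖ψ t‖) * (|c| ^ k / k.factorial * 2)) := by
  have hC : IntervalIntegrable (fun t => (ψ t : ℂ)) volume (-1) 1 := ⟨hi.1.ofReal, hi.2.ofReal⟩
  -- Coefficients obtained by integrating the Taylor polynomial of the kernel against `ψ`. The
  -- condition `hk` is the one under which `Complex.exp_bound'` bounds the remainder by twice its
  -- first term.
  set q : ℕ → ℂ := fun j => lam⁻¹ * ∫ t in (-1 : ℝ)..1,
    (ψ t : ℂ) * ((Complex.I * c * t) ^ j / j.factorial) with hq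
  refine ⟨fun j => (q j).re, fun x hx => ?_⟩
  have e : (ψ x : ℂ) - ∑ j ∈ Finset.range k, q j * ((x ^ j : ℝ) : ℂ)
      = lam⁻¹ * ∫ t in (-1 : ℝ)..1, (ψ t : ℂ) * (Complex.exp (Complex.I * c * x * t)
        - ∑ j ∈ Finset.range k, (Complex.I * c * x * t) ^ j / j.factorial) := by
    have h1 : (ψ x : ℂ) = lam⁻¹ * ∫ t in (-1 : ℝ)..1,
        (ψ t : ℂ) * Complex.exp (Complex.I * c * x * t) := by
      have := he x hx
      rw [prolateF] at this
      rw [← this, inv_mul_cancel_left₀ hl]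
    have h2 : ∑ j ∈ Finset.range k, q j * ((x ^ j : ℝ) : ℂ) = lam⁻¹ * ∫ t in (-1 : ℝ)..1,
        ∑ j ∈ Finset.range k, (ψ t : ℂ) * ((Complex.I * c * x * t) ^ j / j.factorial) := by
      rw [intervalIntegral.integral_finsetSum fun i _ => hC.mul_continuousOn (by fun_prop),
        Finset.mul_sum]
      refine Finset.sum_congr rfl fun j _ => ?_
      rw [hq]
      simp only
      rw [mul_assoc, ← intervalIntegral.integral_mul_const]
      congr 1
      refine intervalIntegral.integral_congr fun t _ => ?_
      push_cast
      rw [show Complex.I * c * x * t = Complex.I * c * t * x by ring, mul_pow (Complex.I * c * t)]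
      ring
    rw [h1, h2, ← mul_sub, ← intervalIntegral.integral_sub (hC.mul_continuousOn (by fun_prop))]
    · simp only [mul_sub, Finset.mul_sum]
    · simp only [← Finset.mul_sum]
      exact hC.mul_continuousOn (by fun_prop)
  have hre : ψ x - ∑ j ∈ Finset.range k, (q j).re * x ^ j
      = ((ψ x : ℂ) - ∑ j ∈ Finset.range k, q j * ((x ^ j : ℝ) : ℂ)).re := by
    rw [Complex.sub_re, Complex.re_sum]
    simp only [Complex.re_mul_ofReal, Complex.ofReal_re]
  rw [hre]
  refine (Complex.abs_re_le_norm _).trans ?_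
  rw [e, norm_mul]
  gcongr
  rw [← intervalIntegral.integral_mul_const]
  refine intervalIntegral.norm_integral_le_of_norm_le (by norm_num)
    (Filter.Eventually.of_forall fun t ht => ?_) (hi.norm.mul_const _)
  have hz : ‖Complex.I * c * x * t‖ ≤ |c| := by
    have h1 : |x| ≤ 1 := abs_le.2 hx
    have h2 : |t| ≤ 1 := abs_le.2 (Ioc_subset_Icc_self ht)
    simp only [norm_mul, Complex.norm_I, one_mul, Complex.norm_real, Real.norm_eq_abs]
    calc |c| * |x| * |t| ≤ |c| * 1 * 1 := by gcongr
      _ = |c| := by ring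
  rw [norm_mul, Complex.norm_real]
  gcongr
  refine (Complex.exp_bound' (le_trans (by gcongr) hk)).trans ?_
  gcongr

/-- The Taylor error `|c|^k / k!` beats `3^k` from `P_k`, `2^k` from the normalization, and `R^k`:
an exponential series in `6 |c| R` dominates. -/
theorem rapidDecay_legCoeff {c : ℝ} {lam : ℂ} (hl : lam ≠ 0) {ψ : ℝ → ℝ}
    (hi : IntervalIntegrable ψ volume (-1) 1)
    (he : ∀ x ∈ Icc (-1 : ℝ) 1, lam * (ψ x : ℂ) = prolateF c (fun t => (ψ t : ℂ)) x) :
    RapidDecay (legCoeff ψ) := by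
  intro R hR
  set M := ∫ t in (-1 : ℝ)..1, ‖ψ t‖ with hM
  refine Summable.of_norm_bounded_eventually_nat
    (g := fun k : ℕ => 4 * ‖lam⁻¹‖ * M * ((6 * |c| * R) ^ k / k.factorial))
    ((Real.summable_pow_div_factorial _).mul_left _) ?_
  obtain ⟨N, hN⟩ := exists_nat_ge (2 * |c|)
  filter_upwards [Filter.eventually_ge_atTop N] with k hk
  have hk' : |c| / (k.succ : ℝ) ≤ 1 / 2 := by
    rw [div_le_iff₀ (by positivity)]
    have : (N : ℝ) ≤ k := by exact_mod_cast hk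
    push_cast
    linarith
  obtain ⟨p, hp⟩ := exists_poly_approx hl hi he hk'
  have hb := abs_integral_mul_legP_le hi hp
  rw [Real.norm_eq_abs, abs_mul, abs_abs, abs_of_pos (pow_pos hR k), legCoeff, abs_mul,
    abs_of_nonneg (by positivity : (0 : ℝ) ≤ (k : ℝ) + 1 / 2)]
  have h2 := natCast_add_one_le_two_pow k
  calc ((k : ℝ) + 1 / 2) * |∫ x in (-1 : ℝ)..1, ψ x * legP k x| * R ^ k
      ≤ 2 ^ k * (2 * (‖lam⁻¹‖ * (M * (|c| ^ k / k.factorial * 2))) * 3 ^ k) * R ^ k := by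
        gcongr
        linarith
    _ = 4 * ‖lam⁻¹‖ * M * ((6 * |c| * R) ^ k / k.factorial) := by
        rw [show (6 : ℝ) = 2 * 3 by norm_num, mul_pow, mul_pow, mul_pow]
        ring

/-! ### Continuous solutions and uniqueness of `χ_n` -/

theorem IsContSolProlateODE.congr {c χ : ℝ} {y z : ℝ → ℝ} (hy : IsContSolProlateODE c χ y)
    (h : ∀ x ∈ Icc (-1 : ℝ) 1, z x = y x) : IsContSolProlateODE c χ z := by
  refine ⟨hy.1.congr h, fun x hx => ?_⟩
  obtain ⟨h1, h2, h3⟩ := hy.2 x hx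
  have e0 : z =ᶠ[nhds x] y := Filter.eventually_of_mem (Icc_mem_nhds hx.1 hx.2) h
  have e1 := e0.deriv
  refine ⟨h1.congr_of_eventuallyEq e0, h2.congr_of_eventuallyEq e1, ?_⟩
  rw [e0.eq_of_nhds, e1.eq_of_nhds, e1.deriv_eq, h3]

namespace IsRegularProlate

variable {c χ : ℝ} {ρ ρ₁ ρ₂ : ℝ → ℝ}

theorem continuous (h : IsRegularProlate c χ ρ ρ₁ ρ₂) : Continuous ρ :=
  continuous_iff_continuousAt.2 fun x => (h.hasDerivAt x).continuousAt

theorem continuous' (h : IsRegularProlate c χ ρ ρ₁ ρ₂) : Continuous ρ₁ :=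
  continuous_iff_continuousAt.2 fun x => (h.hasDerivAt' x).continuousAt

theorem deriv_eq (h : IsRegularProlate c χ ρ ρ₁ ρ₂) : deriv ρ = ρ₁ :=
  funext fun x => (h.hasDerivAt x).deriv

theorem deriv_eq' (h : IsRegularProlate c χ ρ ρ₁ ρ₂) : deriv ρ₁ = ρ₂ :=
  funext fun x => (h.hasDerivAt' x).deriv

theorem isContSol (h : IsRegularProlate c χ ρ ρ₁ ρ₂) : IsContSolProlateODE c χ ρ := by
  refine ⟨h.continuous.continuousOn, fun x hx => ⟨(h.hasDerivAt x).differentiableAt, ?_, ?_⟩⟩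
  · rw [h.deriv_eq]; exact (h.hasDerivAt' x).differentiableAt
  · rw [h.deriv_eq, h.deriv_eq']; exact h.ode x (Ioo_subset_Icc_self hx)

/-- Near `1` the solution is bounded away from zero. -/
theorem exists_near_one (h : IsRegularProlate c χ ρ ρ₁ ρ₂) :
    ∃ s, s ∈ Ioo (0 : ℝ) 1 ∧ ∀ x ∈ Icc s 1, ρ x ≠ 0 := by
  have h1 : ∀ᶠ x in nhds (1 : ℝ), ρ x ≠ 0 := h.continuous.continuousAt.eventually_ne h.apply_one
  obtain ⟨l, hl, hl'⟩ := exists_Ioc_subset_of_mem_nhds h1 ⟨0, one_pos⟩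
  obtain ⟨s, hs1, hs2⟩ := exists_between (max_lt hl one_pos)
  exact ⟨s, ⟨(le_max_right _ _).trans_lt hs1, hs2⟩, fun x hx =>
    hl' ⟨((le_max_left _ _).trans_lt hs1).trans_le hx.1, hx.2⟩⟩

/-- The Wronskian with a solution that stays continuous at `1` vanishes: otherwise the quotient
would diverge logarithmically. -/
theorem wronskian_eq_zero (h : IsRegularProlate c χ ρ ρ₁ ρ₂) {y : ℝ → ℝ}
    (hy : IsContSolProlateODE c χ y) {x : ℝ} (hx : x ∈ Ioo (-1 : ℝ) 1) :
    y x * ρ₁ x - deriv y x * ρ x = 0 := by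
  set w : ℝ → ℝ := fun x => (1 - x ^ 2) * (y x * ρ₁ x - deriv y x * ρ x) with hw
  have hwd : ∀ x ∈ Ioo (-1 : ℝ) 1, HasDerivAt w 0 x := fun x hx => by
    obtain ⟨d1, d2, e⟩ := hy.2 x hx
    have hsq : HasDerivAt (fun s : ℝ => 1 - s ^ 2) (-(2 * x)) x := by
      simpa using (hasDerivAt_pow 2 x).const_sub 1
    refine (hsq.mul ((d1.hasDerivAt.mul (h.hasDerivAt' x)).sub
      (d2.hasDerivAt.mul (h.hasDerivAt x)))).congr_deriv ?_
    simp only [Pi.sub_apply, Pi.mul_apply]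
    linear_combination y x * h.ode x (Ioo_subset_Icc_self hx) - ρ x * e
  have hconst : ∀ s ∈ Ioo (-1 : ℝ) 1, w s = w x := fun s hs =>
    isOpen_Ioo.is_const_of_deriv_eq_zero isPreconnected_Ioo
      (fun t ht => (hwd t ht).differentiableAt.differentiableWithinAt)
      (fun t ht => (hwd t ht).deriv) hs hx
  suffices hK : w x = 0 from (mul_eq_zero.1 hK).resolve_left (one_sub_sq_pos hx).ne'
  by_contra hK
  set K := w x with hKdef
  obtain ⟨s, hs, hρ⟩ := h.exists_near_one
  obtain ⟨B, hB⟩ := (isCompact_Icc (a := s) (b := 1)).exists_bound_of_continuousOn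
    h.continuous.continuousOn
  have hsub : Icc s 1 ⊆ Icc (-1 : ℝ) 1 := Icc_subset_Icc_left (by linarith [hs.1])
  have hzc : ContinuousOn (fun x => y x / ρ x) (Icc s 1) :=
    (hy.1.mono hsub).div h.continuous.continuousOn hρ
  obtain ⟨A, hA⟩ := (isCompact_Icc (a := s) (b := 1)).exists_bound_of_continuousOn hzc
  have hB0 : 0 < B := by
    have := hB 1 ⟨hs.2.le, le_rfl⟩
    exact (norm_pos_iff.2 h.apply_one).trans_le this
  -- Since `(y/ρ)' = -K / ((1 - t²) ρ²)`, with `|ρ| ≤ B` and `1 - t² ≤ 2 (1 - t)`, the derivative of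
  -- `-K y/ρ` is at least `m / (1 - t)`. So `H` below increases, although its logarithm tends to
  -- `-∞` and its other term is bounded.
  set m := K ^ 2 / (2 * B ^ 2) with hm
  have hm0 : 0 < m := by positivity
  set H : ℝ → ℝ := fun x => -K * (y x / ρ x) + m * Real.log (1 - x) with hH
  have hHd : ∀ t ∈ Ico s 1, HasDerivAt H
      (K ^ 2 / ((1 - t ^ 2) * ρ t ^ 2) - m / (1 - t)) t := fun t ht => by
    have ht1 : t ∈ Ioo (-1 : ℝ) 1 := ⟨by linarith [hs.1, ht.1], ht.2⟩
    have hρt := hρ t (Ico_subset_Icc_self ht)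
    have h1t : (1 - t) ≠ 0 := by linarith [ht.2]
    have hqt := (one_sub_sq_pos ht1).ne'
    have hl := ((hasDerivAt_id t).const_sub 1).log h1t
    have hd := (((hy.2 t ht1).1.hasDerivAt.div (h.hasDerivAt t) hρt).const_mul (-K)).add
      (hl.const_mul m)
    refine hd.congr_deriv ?_
    have hwt : (1 - t ^ 2) * (y t * ρ₁ t - deriv y t * ρ t) = K := hconst t ht1
    simp only [id]
    have e1 : K ^ 2 / ((1 - t ^ 2) * ρ t ^ 2) = -K * ((deriv y t * ρ t - y t * ρ₁ t) / ρ t ^ 2) := by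
      field_simp
      linear_combination -hwt
    rw [e1]; ring
  have hmono : MonotoneOn H (Ico s 1) := by
    refine monotoneOn_of_deriv_nonneg (convex_Ico s 1)
      (fun t ht => (hHd t ht).continuousAt.continuousWithinAt) (fun t ht => ?_) fun t ht => ?_
    · exact (hHd t (interior_subset ht)).differentiableAt.differentiableWithinAt
    · have ht' := interior_subset ht
      have ht1 : t ∈ Ioo (-1 : ℝ) 1 := ⟨by linarith [hs.1, ht'.1], ht'.2⟩
      rw [(hHd t ht').deriv, sub_nonneg, hm, div_div]
      have hq := one_sub_sq_pos ht1
      have hρt := hρ t (Ico_subset_Icc_self ht')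
      have hbt : ρ t ^ 2 ≤ B ^ 2 := by
        have := hB t (Ico_subset_Icc_self ht')
        rw [← sq_abs]
        exact pow_le_pow_left₀ (abs_nonneg _) this 2
      have hb : 1 - t ^ 2 ≤ 2 * (1 - t) := by nlinarith [ht1.2]
      have h1t : 0 < 1 - t := by linarith [ht1.2]
      refine div_le_div_of_nonneg_left (sq_nonneg K) (mul_pos hq (by positivity)) ?_
      calc (1 - t ^ 2) * ρ t ^ 2 ≤ 2 * (1 - t) * B ^ 2 := by gcongr
        _ = 2 * B ^ 2 * (1 - t) := by ring
  -- Chosen so that `log (1 - t) ≤ -N` forces `H t < H s`.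
  set N := (|H s| + |K| * A + 1) / m with hN
  have hA0 : 0 ≤ A := (norm_nonneg _).trans (hA 1 ⟨hs.2.le, le_rfl⟩)
  have hN0 : 0 < N := by positivity
  set t := max s (1 - Real.exp (-N)) with ht
  have hts : t ∈ Ico s 1 := ⟨le_max_left _ _, max_lt hs.2 (by linarith [Real.exp_pos (-N)])⟩
  have h1 := hmono ⟨le_rfl, hs.2⟩ hts hts.1
  have h2 : Real.log (1 - t) ≤ -N := by
    rw [← Real.log_exp (-N)]
    refine Real.log_le_log (by linarith [hts.2]) ?_
    linarith [le_max_right s (1 - Real.exp (-N))]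
  have h3 : -K * (y t / ρ t) ≤ |K| * A := by
    refine (le_abs_self _).trans ?_
    rw [abs_mul, abs_neg]
    gcongr
    exact hA t (Ico_subset_Icc_self hts)
  have h4 : m * Real.log (1 - t) ≤ -(|H s| + |K| * A + 1) := by
    calc m * Real.log (1 - t) ≤ m * -N := by gcongr
      _ = _ := by rw [hN]; field_simp
  have h5 : H t ≤ -|H s| - 1 := by
    calc H t = -K * (y t / ρ t) + m * Real.log (1 - t) := rfl
      _ ≤ _ := by linarith
  linarith [neg_abs_le (H s)]

/-- Uniqueness for the initial value problem inside `(-1, 1)`. -/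
theorem eqOn_of_initial {y z : ℝ → ℝ} (hy : IsContSolProlateODE c χ y)
    (hz : IsContSolProlateODE c χ z) {x₀ : ℝ} (hx₀ : x₀ ∈ Ioo (-1 : ℝ) 1) (h0 : y x₀ = z x₀)
    (h1 : deriv y x₀ = deriv z x₀) {x : ℝ} (hx : x ∈ Ioo (-1 : ℝ) 1) : y x = z x := by
  -- The first-order system has coefficients singular at `±1`; a uniform Lipschitz constant needs an
  -- interval bounded away from them.
  obtain ⟨r, hr, hr1⟩ := exists_between (max_lt (abs_lt.2 hx) (abs_lt.2 hx₀))
  have hxr : x ∈ Ioo (-r) r := abs_lt.1 ((le_max_left _ _).trans_lt hr)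
  have hx₀r : x₀ ∈ Ioo (-r) r := abs_lt.1 ((le_max_right _ _).trans_lt hr)
  have hr0 : 0 < r := (abs_nonneg x).trans_lt (abs_lt.2 hxr)
  have hsub : ∀ t ∈ Ioo (-r) r, t ∈ Ioo (-1 : ℝ) 1 := fun t ht =>
    ⟨by linarith [ht.1], by linarith [ht.2]⟩
  have hq : 0 < 1 - r ^ 2 := by nlinarith
  set v : ℝ → ℝ × ℝ → ℝ × ℝ := fun t p =>
    (p.2, (2 * t * p.2 - (χ - c ^ 2 * t ^ 2) * p.1) / (1 - t ^ 2)) with hv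
  set K : NNReal := Real.toNNReal (1 + (2 + (|χ| + c ^ 2)) / (1 - r ^ 2)) with hK
  have hlip : ∀ t ∈ Ioo (-r) r, LipschitzOnWith K (v t) univ := fun t ht => by
    have htq : 1 - r ^ 2 ≤ 1 - t ^ 2 := by nlinarith [ht.1, ht.2]
    have ht1 : |t| ≤ 1 := (abs_lt.2 (hsub t ht)).le
    refine LipschitzOnWith.of_dist_le_mul fun p _ q _ => ?_
    have hKc : (K : ℝ) = 1 + (2 + (|χ| + c ^ 2)) / (1 - r ^ 2) :=
      Real.coe_toNNReal _ (by positivity)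
    have hd1 : |p.1 - q.1| ≤ dist p q := by
      rw [← Real.dist_eq, Prod.dist_eq]; exact le_max_left _ _
    have hd2 : |p.2 - q.2| ≤ dist p q := by
      rw [← Real.dist_eq, Prod.dist_eq]; exact le_max_right _ _
    have hD : 0 ≤ dist p q := dist_nonneg
    rw [hKc, Prod.dist_eq (x := v t p)]
    refine max_le ?_ ?_
    · rw [Real.dist_eq]
      calc |p.2 - q.2| ≤ 1 * dist p q := by rw [one_mul]; exact hd2
        _ ≤ _ := by gcongr; exact le_add_of_nonneg_right (by positivity)
    · rw [Real.dist_eq]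
      have e : (v t p).2 - (v t q).2
          = (2 * t * (p.2 - q.2) - (χ - c ^ 2 * t ^ 2) * (p.1 - q.1)) / (1 - t ^ 2) := by
        simp only [hv]; ring
      rw [e, abs_div, abs_of_pos (hq.trans_le htq)]
      have hχ : |χ - c ^ 2 * t ^ 2| ≤ |χ| + c ^ 2 := by
        refine (abs_sub _ _).trans ?_
        gcongr
        rw [abs_of_nonneg (by positivity)]
        exact mul_le_of_le_one_right (by positivity) ((sq_le_one_iff_abs_le_one t).2 ht1)
      have hnum : |2 * t * (p.2 - q.2) - (χ - c ^ 2 * t ^ 2) * (p.1 - q.1)|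
          ≤ (2 + (|χ| + c ^ 2)) * dist p q := by
        refine (abs_sub _ _).trans ?_
        rw [abs_mul, abs_mul, abs_mul, abs_two, add_mul]
        gcongr
        linarith
      calc _ ≤ (2 + (|χ| + c ^ 2)) * dist p q / (1 - r ^ 2) := by gcongr
        _ = (2 + (|χ| + c ^ 2)) / (1 - r ^ 2) * dist p q := by ring
        _ ≤ _ := by gcongr; linarith
  have hsol {u : ℝ → ℝ} (hu : IsContSolProlateODE c χ u) : ∀ t ∈ Ioo (-r) r,
      HasDerivAt (fun t => (u t, deriv u t)) (v t (u t, deriv u t)) t ∧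
        (u t, deriv u t) ∈ (univ : Set (ℝ × ℝ)) := fun t ht => by
    obtain ⟨d1, d2, e⟩ := hu.2 t (hsub t ht)
    refine ⟨(d1.hasDerivAt.prodMk d2.hasDerivAt).congr_deriv ?_, mem_univ _⟩
    have := (one_sub_sq_pos (hsub t ht)).ne'
    simp only [hv, Prod.mk.injEq, true_and]
    rw [eq_div_iff this]
    linear_combination e
  have := ODE_solution_unique_of_mem_Ioo (v := v) (s := fun _ => univ) (K := K) hlip hx₀r
    (hsol hy) (hsol hz) (by simp only [h0, h1]) hxr
  exact congrArg Prod.fst this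

/-- Every solution continuous on `[-1, 1]` is a multiple of the regular one. -/
theorem multiple (h : IsRegularProlate c χ ρ ρ₁ ρ₂) {y : ℝ → ℝ}
    (hy : IsContSolProlateODE c χ y) : ∃ a : ℝ, ∀ x ∈ Icc (-1 : ℝ) 1, y x = a * ρ x := by
  obtain ⟨s, hs, hρ⟩ := h.exists_near_one
  have hs1 : s ∈ Ioo (-1 : ℝ) 1 := ⟨by linarith [hs.1], hs.2⟩
  have hρs := hρ s ⟨le_rfl, hs.2.le⟩
  have hd (x : ℝ) : HasDerivAt (fun x => y s / ρ s * ρ x) (y s / ρ s * ρ₁ x) x :=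
    (h.hasDerivAt x).const_mul _
  have hd1 : deriv (fun x => y s / ρ s * ρ x) = fun x => y s / ρ s * ρ₁ x :=
    funext fun x => (hd x).deriv
  have hz : IsContSolProlateODE c χ fun x => y s / ρ s * ρ x := by
    refine ⟨(h.continuous.const_mul _).continuousOn, fun x hx => ⟨(hd x).differentiableAt, ?_, ?_⟩⟩
    · rw [hd1]; exact ((h.hasDerivAt' x).const_mul _).differentiableAt
    · rw [hd1, ((h.hasDerivAt' x).const_mul _).deriv]
      linear_combination (y s / ρ s) * h.ode x (Ioo_subset_Icc_self hx)
  refine ⟨y s / ρ s, fun x hx => ?_⟩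
  -- The values at `s` agree by the choice of the factor, the derivatives by the vanishing
  -- Wronskian.
  have hoo : EqOn y (fun x => y s / ρ s * ρ x) (Ioo (-1) 1) := fun x hx =>
    eqOn_of_initial hy hz hs1 (by field_simp) (by
      rw [hd1]
      have := h.wronskian_eq_zero hy hs1
      field_simp
      linear_combination -this) hx
  exact hoo.of_subset_closure hy.1 hz.1 Ioo_subset_Icc_self
    (closure_Ioo (by norm_num : (-1 : ℝ) ≠ 1)).ge hx

/-- For uniqueness, a nonzero multiple of `ρ` solves both equations; their difference at a point
where `ρ ≠ 0` gives `χ' = χ`. -/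
theorem existsUnique_eigenvalue (h : IsRegularProlate c χ ρ ρ₁ ρ₂) {ψ : ℝ → ℝ}
    (hψ : ∀ x ∈ Icc (-1 : ℝ) 1, ψ x = ρ x) :
    IsProlateEigenvalue c ψ χ ∧ ∀ χ', IsProlateEigenvalue c ψ χ' → χ' = χ := by
  refine ⟨⟨⟨ρ, h.isContSol, 1, by norm_num, h.apply_one⟩, fun y hy => ?_⟩, fun χ' h' => ?_⟩
  · obtain ⟨a, ha⟩ := h.multiple hy
    exact ⟨a, fun x hx => by rw [ha x hx, hψ x hx]⟩
  · obtain ⟨y, hy, x, hx, hyx⟩ := h'.exists_sol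
    obtain ⟨a, ha⟩ := h'.multiple y hy
    have ha0 : a ≠ 0 := fun h0 => hyx (by rw [ha x hx, h0, zero_mul])
    obtain ⟨s, hs, hρ⟩ := h.exists_near_one
    have hs1 : s ∈ Ioo (-1 : ℝ) 1 := ⟨by linarith [hs.1], hs.2⟩
    have hρs := hρ s ⟨le_rfl, hs.2.le⟩
    have hz : IsContSolProlateODE c χ' fun x => a * ρ x :=
      hy.congr fun x hx => by rw [ha x hx, hψ x hx]
    have e := (hz.2 s hs1).2.2
    have hd1 : deriv (fun x => a * ρ x) = fun x => a * ρ₁ x :=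
      funext fun x => ((h.hasDerivAt x).const_mul a).deriv
    rw [hd1, ((h.hasDerivAt' s).const_mul a).deriv] at e
    have h2 : (χ' - χ) * (a * ρ s) = 0 := by
      linear_combination e - a * h.ode s (Ioo_subset_Icc_self hs1)
    exact sub_eq_zero.1 ((mul_eq_zero.1 h2).resolve_right (mul_ne_zero ha0 hρs))

/-- The prolate equation in terms of Legendre coefficients. -/
theorem legCoeff_rel (h : IsRegularProlate c χ ρ ρ₁ ρ₂) (k : ℕ) :
    (k : ℝ) * ((k : ℝ) + 1) * legCoeff ρ k
      = χ * legCoeff ρ k - c ^ 2 * legCoeff (fun x => x * (x * ρ x)) k := by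
  have h0 := h.continuous
  have h1 := h.continuous'
  have hP := continuous_legP k
  -- Lagrange's identity for `ρ` and `P_k`; both terms of the bracket vanish at `±1`.
  have hder : ∀ x ∈ uIcc (-1 : ℝ) 1, HasDerivAt
      (fun x => (1 - x ^ 2) * ρ₁ x * legP k x - ρ x * legFlux legP 0 k x)
      ((k : ℝ) * ((k : ℝ) + 1) * (ρ x * legP k x)
        - (χ * (ρ x * legP k x) - c ^ 2 * (x * (x * ρ x) * legP k x))) x := fun x hx => by
    rw [uIcc_of_le (by norm_num)] at hx
    obtain ⟨d, hd, e⟩ := legSeq_legP.hasDerivAt k (mem_univ x)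
    have hf := legSeq_legP.hasDerivAt_flux k (mem_univ x)
    have hsq : HasDerivAt (fun s : ℝ => 1 - s ^ 2) (-(2 * x)) x := by
      simpa using (hasDerivAt_pow 2 x).const_sub 1
    refine (((hsq.mul (h.hasDerivAt' x)).mul hd).sub ((h.hasDerivAt x).mul hf)).congr_deriv ?_
    simp only [Pi.mul_apply, ← e]
    linear_combination legP k x * h.ode x hx
  have hint := intervalIntegral.integral_eq_sub_of_hasDerivAt hder
    (Continuous.intervalIntegrable (by fun_prop) _ _)
  have hflux : legFlux legP 0 k 1 = 0 ∧ legFlux legP 0 k (-1) = 0 := by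
    constructor
    · obtain ⟨d, -, e⟩ := legSeq_legP.hasDerivAt k (mem_univ 1)
      rw [← e]; ring
    · obtain ⟨d, -, e⟩ := legSeq_legP.hasDerivAt k (mem_univ (-1))
      rw [← e]; ring
  rw [intervalIntegral.integral_sub (Continuous.intervalIntegrable (by fun_prop) _ _)
    (Continuous.intervalIntegrable (by fun_prop) _ _),
    intervalIntegral.integral_sub (Continuous.intervalIntegrable (by fun_prop) _ _)
    (Continuous.intervalIntegrable (by fun_prop) _ _), intervalIntegral.integral_const_mul,
    intervalIntegral.integral_const_mul, intervalIntegral.integral_const_mul,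
    hflux.1, hflux.2] at hint
  simp only [legCoeff]
  linear_combination ((k : ℝ) + 1 / 2) * hint

end IsRegularProlate

/-! ### Assembly -/

theorem legCoeff_congr {f g : ℝ → ℝ} (h : ∀ x ∈ Icc (-1 : ℝ) 1, f x = g x) :
    legCoeff f = legCoeff g := by
  funext k
  rw [legCoeff, legCoeff, intervalIntegral.integral_congr fun x hx => ?_]
  rw [uIcc_of_le (by norm_num)] at hx
  simp only [h x hx]

theorem mainTheorem7 (c : ℝ) (hc : 0 < c) (lam : ℕ → ℂ) (ψ : ℕ → ℝ → ℝ)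
    (hψ : IsPSWFSystem c lam ψ) (n : ℕ) :
    (∃! χ : ℝ, IsProlateEigenvalue c (ψ n) χ) ∧
    (∀ t ∈ Ioo (-1 : ℝ) 1, Summable (fun k : ℕ => legCoeff (ψ n) k * legQ k t)) ∧
    ContDiffOn ℝ ∞ (tildePhi (ψ n)) (Ioo (-1 : ℝ) 1) ∧
    ∀ χ : ℝ, IsProlateEigenvalue c (ψ n) χ → ∀ t ∈ Ioo (-1 : ℝ) 1,
      ((1 - t ^ 2) * iteratedDeriv 2 (tildePhi (ψ n)) t
          - 2 * t * iteratedDeriv 1 (tildePhi (ψ n)) t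
          + (χ - c ^ 2 * t ^ 2) * tildePhi (ψ n) t
        = -c ^ 2 * (legCoeff (ψ n) 0 * t + legCoeff (ψ n) 1 / 3)) ∧
      ((1 - t ^ 2) * iteratedDeriv 3 (tildePhi (ψ n)) t
          - 4 * t * iteratedDeriv 2 (tildePhi (ψ n)) t
          + (χ - c ^ 2 * t ^ 2 - 2) * iteratedDeriv 1 (tildePhi (ψ n)) t
          - 2 * c ^ 2 * t * tildePhi (ψ n) t
        = -c ^ 2 * legCoeff (ψ n) 0) ∧
      ∀ k : ℕ, 2 ≤ k →
        (1 - t ^ 2) * iteratedDeriv (k + 2) (tildePhi (ψ n)) t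
          - 2 * ((k : ℝ) + 1) * t * iteratedDeriv (k + 1) (tildePhi (ψ n)) t
          + (χ - (k : ℝ) * ((k : ℝ) + 1) - c ^ 2 * t ^ 2) * iteratedDeriv k (tildePhi (ψ n)) t
          - 2 * c ^ 2 * (k : ℝ) * t * iteratedDeriv (k - 1) (tildePhi (ψ n)) t
          - c ^ 2 * (k : ℝ) * ((k : ℝ) - 1) * iteratedDeriv (k - 2) (tildePhi (ψ n)) t = 0 := by
  obtain ⟨χ₀, ρ, ρ₁, ρ₂, hρ, hψρ⟩ := hψ.exists_isRegularProlate hc.ne' n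
  obtain ⟨hχ₀, huniq⟩ := hρ.existsUnique_eigenvalue hψρ
  have hi := intervalIntegrable_of_memLp_volIcc (hψ.memLp n)
  have hα := rapidDecay_legCoeff (hψ.lam_ne_zero hc.ne' n) hi (hψ.eigen n)
  have hs : ContDiffOn ℝ ∞ (tildePhi (ψ n)) (Ioo (-1) 1) := hα.contDiffOn_legQSum
  refine ⟨⟨χ₀, hχ₀, huniq⟩, fun t ht => hα.summable_legQ ht, hs, fun χ hχ t ht => ?_⟩
  obtain rfl := huniq χ hχ
  have h0 := tildePhi_eqs_of_rel (c := c) (χ := χ) hα hi fun k => by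
    rw [legCoeff_congr hψρ, legCoeff_congr (f := fun x => x * (x * ψ n x))
      (g := fun x => x * (x * ρ x)) (fun x hx => by rw [hψρ x hx])]
    exact hρ.legCoeff_rel k
  obtain ⟨h1, h2⟩ := prolate_iteratedDeriv_eqs isOpen_Ioo hs h0
  exact ⟨h0 t ht, h1 t ht, fun k hk => h2 k hk t ht⟩
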